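/- Let $L$ and $M$ be two positive integers. For $z\in\mathbb{C}^*$ put $$D_L(z)=1+\sum_{\ell=1}^L d(\ell)z^{-\ell},\qquad d(\ell)=(-1)^\ell\binom{L}{\ell}\prod_{k=0}^{\ell-1}\frac{1/2-L+k}{3/2+k},$$ and $S(z)=(2+z+1/z)^M D_L(z)D_L(1/z)$. Consider, for a function $R$ on $\mathbb{C}^*$, the perfect reconstruction equation $$R(z)S(z)+R(-z)S(-z)=2\quad\text{for all }z\in\mathbb{C}^*.\tag{PR}$$ Let $r$ be the unique real polynomial of degree at most $M+L-1$ such that $R(z)=r\left(\frac{2+z+1/z}{4}\right)$ satisfies (PR), and let $s(y)=y^M\sum_{n=0}^L\binom{2L+1}{2n}y^n$. Let $Q$ be a function such that $Q(1/z)$ is a real polynomial of $z$ which does not vanish on the unit circle and such that, for some real polynomial $q$, the function $R(z)=p\left(\frac{2+z+1/z}{4}\right)$ with $p(y)=r(y)+s(1-y)q(y)$ satisfies (PR) and $R(z)=Q(z)Q(1/z)$ for all $z\in\mathbb{C}^*$. Put $F(z)=Q(z)(1+1/z)^M$, and let $\{H_0,G_0\}$ be the $L$-approximate Hilbert wavelet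 filter pair with common factor $F$, that is, $$H_0(z)=F(z)D_L(z),\qquad G_0(z)=F(z)D_L(1/z)z^{-L},\qquad H_0(1)=G_0(1)=\sqrt2$$ (the last condition fixes the sign of $Q$). Let $A\in\{H_0,G_0\}$. Then for every $\omega\in\mathbb{R}$ the infinite product below converges, and there are real-valued square integrable functions $\phi_A$ and $\psi_A$ on $\mathbb{R}$ (the father and mother wavelets of $A$) whose Fourier transforms, in the normalization $\hat f(\omega)=\int f(t)\mathrm{e}^{-\mathrm{i}t\omega}\,\mathrm{d}t$ extended to $L^2(\mathbb{R})$, are $$\hat\phi_A(\omega)=\prod_{j=1}^\infty\left[2^{-1/2}A(\mathrm{e}^{\mathrm{i}2^{-j}\omega})\right],\qquad \hat\psi_A(\omega)=2^{-1/2}A_1(\mathrm{e}^{\mathrm{i}\omega/2})\,\hat\phi_A(\omega/2),\qquad A_1(z)=z^{-1}A(-z^{-1}).$$ Writing $\psi_H=\psi_{H_0}$, $\psi_G=\psi_{G_0}$, $\psi_{H,j,k}(t)=2^{j/2}\psi_H(2^jt-k)$ and $\psi_{G,j,k}(t)=2^{j/2}\psi_G(2^jt-k)$, each of the two families $(\psi_{H,j,k})_{j,k\in\mathbb{Z}}$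 and $(\psi_{G,j,k})_{j,k\in\mathbb{Z}}$ is an orthonormal basis of the complex Hilbert space $L^2(\mathbb{R})$. -/

import Mathlib

open MeasureTheory Polynomial
open scoped FourierTransform

noncomputable section

namespace CommonFactorWavelet

/-- The coefficients `d(ℓ)` of the maximally flat filter of length `L` (with `d(0) = 1`). -/
def thiranCoeff (L ℓ : ℕ) : ℝ :=
  (-1) ^ ℓ * (L.choose ℓ : ℝ) *
    ∏ k ∈ Finset.range ℓ, ((1 / 2 - (L : ℝ) + (k : ℝ)) / (3 / 2 + (k : ℝ)))

/-- The transfer function `D_L(z) = 1 + ∑_{ℓ=1}^L d(ℓ) z^{-ℓ}`. -/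
def thiranD (L : ℕ) (z : ℂ) : ℂ :=
  1 + ∑ ℓ ∈ Finset.Icc 1 L, (thiranCoeff L ℓ : ℂ) * z⁻¹ ^ ℓ

/-- The transfer function `∑ₙ q(n) z^{-n}` of the causal FIR filter whose impulse response is the
coefficient sequence of the real polynomial `q`. -/
def causalTransfer (q : ℝ[X]) (z : ℂ) : ℂ := aeval z⁻¹ q

/-- `H₀` and `G₀` are the transfer functions of an `L`-approximate Hilbert wavelet filter pair with
common factor `F`. Transfer functions are functions of a nonzero complex variable. -/
structure IsApproxHilbertPair (L : ℕ) (F H₀ G₀ : ℂ → ℂ) : Prop where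
  eq_H : ∀ z : ℂ, z ≠ 0 → H₀ z = F z * thiranD L z
  eq_G : ∀ z : ℂ, z ≠ 0 → G₀ z = F z * thiranD L z⁻¹ * z⁻¹ ^ L
  H_one : H₀ 1 = (Real.sqrt 2 : ℂ)
  G_one : G₀ 1 = (Real.sqrt 2 : ℂ)

/-- `S(z) = (2 + z + 1/z)^M D_L(z) D_L(1/z)`. -/
def symbolS (L M : ℕ) (z : ℂ) : ℂ :=
  (2 + z + z⁻¹) ^ M * thiranD L z * thiranD L z⁻¹

/-- The perfect reconstruction equation `R(z) S(z) + R(-z) S(-z) = 2` on the nonzero complex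
numbers. -/
def PerfectReconstruction (L M : ℕ) (R : ℂ → ℂ) : Prop :=
  ∀ z : ℂ, z ≠ 0 → R z * symbolS L M z + R (-z) * symbolS L M (-z) = 2

/-- The function `z ↦ p((2 + z + 1/z)/4)` attached to a real polynomial `p`. -/
def symmetricSymbol (p : ℝ[X]) (z : ℂ) : ℂ := aeval ((2 + z + z⁻¹) / 4) p

/-- `s(y) = y^M ∑_{n=0}^L binom(2L+1, 2n) y^n`. -/
def polyS (L M : ℕ) : ℝ[X] :=
  X ^ M * ∑ n ∈ Finset.range (L + 1), C (((2 * L + 1).choose (2 * n) : ℕ) : ℝ) * X ^ n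

/-- `r` is the real polynomial of degree at most `M + L - 1` such that `r((2 + z + 1/z)/4)` solves
the perfect reconstruction equation. -/
structure IsMinimalSolution (L M : ℕ) (r : ℝ[X]) : Prop where
  degree_le : r.natDegree ≤ M + L - 1
  pr : PerfectReconstruction L M (symmetricSymbol r)

/-- The causal FIR filter with impulse response `Q` comes from the spectral factorization
`R(z) = Q(z) Q(1/z)` of a solution `R(z) = p((2 + z + 1/z)/4)`, `p(y) = r(y) + s(1 - y) q(y)`,
of the perfect reconstruction equation, and `Q` has no zero on the unit circle. -/
def IsSpectralFactor (L M : ℕ) (Q : ℝ[X]) : Prop :=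
  ∃ r q : ℝ[X], IsMinimalSolution L M r ∧
    PerfectReconstruction L M (symmetricSymbol (r + (polyS L M).comp (1 - X) * q)) ∧
    (∀ z : ℂ, z ≠ 0 → symmetricSymbol (r + (polyS L M).comp (1 - X) * q) z =
      causalTransfer Q z * causalTransfer Q z⁻¹) ∧
    ∀ z : ℂ, ‖z‖ = 1 → causalTransfer Q z⁻¹ ≠ 0

/-- The factor `2^{-1/2} A(e^{i 2^{-j} ω})`. -/
def scalingFactor (A : ℂ → ℂ) (ω : ℝ) (j : ℕ) : ℂ :=
  ((Real.sqrt 2)⁻¹ : ℂ) * A (Complex.exp (Complex.I * (((2 : ℝ) ^ j)⁻¹ * ω : ℝ)))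

/-- `φ̂(ω) = ∏_{j ≥ 1} 2^{-1/2} A(e^{i 2^{-j} ω})` for the low-pass filter `A`. -/
def fatherHat (A : ℂ → ℂ) (ω : ℝ) : ℂ := ∏' j : ℕ, scalingFactor A ω (j + 1)

/-- The high-pass filter `z^{-1} A(-z^{-1})` associated with the low-pass filter `A`. -/
def highPass (A : ℂ → ℂ) (z : ℂ) : ℂ := z⁻¹ * A (-z⁻¹)

/-- `ψ̂(ω) = 2^{-1/2} A₁(e^{i ω/2}) φ̂(ω/2)`, with `A₁` the high-pass filter of `A`. -/
def motherHat (A : ℂ → ℂ) (ω : ℝ) : ℂ :=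
  ((Real.sqrt 2)⁻¹ : ℂ) * highPass A (Complex.exp (Complex.I * (ω / 2 : ℝ))) *
    fatherHat A (ω / 2)

/-- `f` is square integrable and its (Plancherel) Fourier transform, in the normalization
`f̂(ω) = ∫ f(t) e^{-i t ω} dt`, is `g`. Mathlib's Fourier transform at `ξ` is `f̂(2πξ)`. -/
def HasL2FourierTransform (f : ℝ → ℝ) (g : ℝ → ℂ) : Prop :=
  ∃ hf : MemLp (fun t : ℝ => (f t : ℂ)) 2 volume,
    ((𝓕 (hf.toLp (fun t : ℝ => (f t : ℂ))) : Lp ℂ 2 (volume : Measure ℝ)) : ℝ → ℂ)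
      =ᵐ[volume] fun ξ : ℝ => g (2 * Real.pi * ξ)

/-- `φ` and `ψ` are the (real-valued) father and mother wavelets of the low-pass filter `A`. -/
structure IsWaveletPair (A : ℂ → ℂ) (φ ψ : ℝ → ℝ) : Prop where
  multipliable : ∀ ω : ℝ, Multipliable fun j : ℕ => scalingFactor A ω (j + 1)
  father : HasL2FourierTransform φ (fatherHat A)
  mother : HasL2FourierTransform ψ (motherHat A)

/-- `ψ_{j,k}(t) = 2^{j/2} ψ(2^j t - k)`. -/
def dilate (ψ : ℝ → ℝ) (i : ℤ × ℤ) (t : ℝ) : ℝ :=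
  (2 : ℝ) ^ ((i.1 : ℝ) / 2) * ψ ((2 : ℝ) ^ i.1 * t - (i.2 : ℝ))

/-- The family `f` is an orthonormal (Hilbert) basis of `L²(ℝ)`, the Hilbert space of
complex-valued square integrable functions. -/
def IsOrthonormalBasisL2 {ι : Type*} (f : ι → ℝ → ℝ) : Prop :=
  ∃ b : HilbertBasis ι ℂ (Lp ℂ 2 (volume : Measure ℝ)),
    ∀ i : ι, (b i : ℝ → ℂ) =ᵐ[volume] fun t : ℝ => (f i t : ℂ)

end CommonFactorWavelet

end

noncomputable section

namespace CommonFactorWavelet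

open Filter Topology

/-! For `A` equal to `H₀` or `G₀`, A(z)A(1/z) = Q(z)Q(1/z)(2+z+1/z)^M D_L(z)D_L(1/z) = R(z)S(z),
because the delay z^{-L} of `G₀` cancels. Perfect reconstruction thus says that m = 2^{-1/2}A is a
conjugate quadrature filter: |m(ξ)|² + |m(ξ+1/2)|² = 1. On the unit circle A can vanish only at -1,
since Q has no zero there by hypothesis and D_L has none by the closed form `two_mul_mul_thiranD`.
Hence m has no zero on |ξ| ≤ 1/4, which is Cohen's criterion, and `IsCohenFilter` holds.

The rest is the theory of Mallat and Cohen. Let Φ be the infinite product of the m(2^{-j}ξ). The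
quadrature identity gives the exact Fourier coefficients of the finite products of |m|²; a positive
lower bound for |Φ| on [-1/2, 1/2] lets dominated convergence carry them to |Φ|², so the integer
translates of the father wavelet are orthonormal
(`IsCohenFilter.integral_norm_scalingHat_sq_mul_cis`). With m₁ the high-pass response, the matrix of
m and m₁ at ξ and ξ + 1/2 is unitary, so each scaling space splits orthogonally into the next
coarser one and a wavelet space (`orthonormal_wavelet`, `inner_scaling_wavelet`, `scaling_mem_sup`).
The scaling spaces have dense union (`eq_zero_of_inner_scaling`) and trivial intersection
(`eq_zero_of_mem_closure_span_atom`), and `exists_hilbertBasis_of_multiresolution` concludes. -/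

/-- The character `x ↦ exp (2π i x)` of the real line. -/
def cis (x : ℝ) : ℂ := Complex.exp ((2 * Real.pi * x : ℝ) * Complex.I)

theorem cis_add (x y : ℝ) : cis (x + y) = cis x * cis y := by
  rw [cis, cis, cis, ← Complex.exp_add]
  congr 1
  push_cast
  ring

@[simp] theorem cis_zero : cis 0 = 1 := by simp [cis]

@[simp] theorem norm_cis (x : ℝ) : ‖cis x‖ = 1 := Complex.norm_exp_ofReal_mul_I _

theorem cis_ne_zero (x : ℝ) : cis x ≠ 0 := Complex.exp_ne_zero _

theorem cis_neg (x : ℝ) : cis (-x) = (cis x)⁻¹ := by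
  rw [cis, cis, ← Complex.exp_neg]
  congr 1
  push_cast
  ring

theorem conj_cis (x : ℝ) : (starRingEnd ℂ) (cis x) = cis (-x) := by
  rw [cis, cis, ← Complex.exp_conj, map_mul, Complex.conj_ofReal, Complex.conj_I]
  congr 1
  push_cast
  ring

@[fun_prop] theorem continuous_cis : Continuous cis := by
  unfold cis
  fun_prop

theorem cis_int (n : ℤ) : cis n = 1 := by
  rw [cis, ← Complex.exp_int_mul_two_pi_mul_I n]
  congr 1
  push_cast
  ring

theorem cis_half : cis (1 / 2) = -1 := by
  rw [cis, ← Complex.exp_pi_mul_I]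
  congr 1
  push_cast
  ring

theorem cis_int_mul (n : ℤ) (x : ℝ) : cis (n * x) = cis x ^ n := by
  rw [cis, cis, ← Complex.exp_int_mul]
  congr 1
  push_cast
  ring

/-! ### Dilations, translations and modulations of L²(ℝ), and the Plancherel transform. -/

/-- The affine map `t ↦ a t - b` is quasi measure preserving. -/
theorem quasiMeasurePreserving_affine {a : ℝ} (ha : 0 < a) (b : ℝ) :
    Measure.QuasiMeasurePreserving (fun t : ℝ => a * t - b) volume volume := by
  refine ⟨by fun_prop, ?_⟩
  have h : (fun t : ℝ => a * t - b) = (fun t => t - b) ∘ (fun t => a * t) := rfl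
  rw [h, ← Measure.map_map (by fun_prop) (by fun_prop), Real.map_volume_mul_left ha.ne',
    Measure.map_smul, (measurePreserving_sub_right volume b).map_eq]
  exact Measure.smul_absolutelyContinuous

theorem integral_comp_affine {E : Type*} [NormedAddCommGroup E] [NormedSpace ℝ E]
    {a : ℝ} (ha : 0 < a) (b : ℝ) (f : ℝ → E) :
    ∫ t, f (a * t - b) = a⁻¹ • ∫ t, f t := by
  rw [Measure.integral_comp_mul_left (fun t => f (t - b)) a, integral_sub_right_eq_self f b,
    abs_of_pos (inv_pos.2 ha)]

theorem integrable_comp_affine {E : Type*} [NormedAddCommGroup E]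
    {a : ℝ} (ha : 0 < a) (b : ℝ) {f : ℝ → E} (hf : Integrable f) :
    Integrable fun t => f (a * t - b) :=
  (hf.comp_sub_right b).comp_mul_left' ha.ne'

/-- The function `t ↦ √a e^{2π i c t} f(a t - b)`. -/
def modDil (a b c : ℝ) (f : ℝ → ℂ) (t : ℝ) : ℂ := (√a : ℂ) * cis (c * t) * f (a * t - b)

theorem norm_modDil_sq {a : ℝ} (ha : 0 < a) (b c : ℝ) (f : ℝ → ℂ) (t : ℝ) :
    ‖modDil a b c f t‖ ^ 2 = a * ‖f (a * t - b)‖ ^ 2 := by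
  rw [modDil, norm_mul, norm_mul, norm_cis, mul_one, mul_pow, Complex.norm_real,
    Real.norm_of_nonneg (Real.sqrt_nonneg _), Real.sq_sqrt ha.le]

theorem modDil_congr_ae {a : ℝ} (ha : 0 < a) (b c : ℝ) {f g : ℝ → ℂ} (h : f =ᵐ[volume] g) :
    modDil a b c f =ᵐ[volume] modDil a b c g := by
  filter_upwards [(quasiMeasurePreserving_affine ha b).ae h] with t ht
  rw [modDil, modDil, ht]

theorem memLp_modDil {a : ℝ} (ha : 0 < a) (b c : ℝ) {f : ℝ → ℂ} (hf : MemLp f 2 volume) :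
    MemLp (modDil a b c f) 2 volume := by
  have hm : AEStronglyMeasurable (modDil a b c f) volume := by
    refine AEStronglyMeasurable.mul (Continuous.aestronglyMeasurable (by fun_prop)) ?_
    exact hf.1.comp_quasiMeasurePreserving (quasiMeasurePreserving_affine ha b)
  rw [memLp_two_iff_integrable_sq_norm hm]
  simp_rw [norm_modDil_sq ha]
  exact (integrable_comp_affine ha b
    ((memLp_two_iff_integrable_sq_norm hf.1).1 hf)).const_mul a

theorem inner_Lp_eq_integral (f g : Lp ℂ 2 (volume : Measure ℝ)) :
    inner ℂ f g = ∫ t, (starRingEnd ℂ) (f t) * g t := by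
  rw [L2.inner_def]
  exact integral_congr_ae (.of_forall fun t => mul_comm _ _)

theorem integral_modDil_mul {a : ℝ} (ha : 0 < a) (b c : ℝ) (f g : ℝ → ℂ) :
    ∫ t, (starRingEnd ℂ) (modDil a b c f t) * modDil a b c g t =
      ∫ t, (starRingEnd ℂ) (f t) * g t := by
  have h : ∀ t, (starRingEnd ℂ) (modDil a b c f t) * modDil a b c g t =
      (a : ℂ) * ((starRingEnd ℂ) (f (a * t - b)) * g (a * t - b)) := by
    intro t
    have h1 : (√a : ℂ) * (√a : ℂ) = a := by
      rw [← Complex.ofReal_mul, Real.mul_self_sqrt ha.le]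
    have h2 : cis (-(c * t)) * cis (c * t) = 1 := by rw [← cis_add]; simp
    simp only [modDil, map_mul, conj_cis, Complex.conj_ofReal]
    linear_combination ((starRingEnd ℂ) (f (a * t - b)) * g (a * t - b)) *
      (cis (-(c * t)) * cis (c * t) * h1 + a * h2)
  simp_rw [h]
  rw [integral_const_mul,
    integral_comp_affine ha b (fun t => (starRingEnd ℂ) (f t) * g t), Complex.real_smul]
  have : (a : ℂ) ≠ 0 := by exact_mod_cast ha.ne'
  push_cast
  field_simp

/-- The linear isometry `f ↦ √a e^{2π i c t} f(a t - b)` of `L²(ℝ)`. -/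
def modDilLp (a b c : ℝ) (ha : 0 < a) :
    Lp ℂ 2 (volume : Measure ℝ) →ₗᵢ[ℂ] Lp ℂ 2 (volume : Measure ℝ) :=
  LinearMap.isometryOfInner
    { toFun := fun f => (memLp_modDil ha b c (Lp.memLp f)).toLp
      map_add' := by
        intro f g
        apply Lp.ext
        refine (MemLp.coeFn_toLp _).trans ?_
        refine (modDil_congr_ae ha b c (Lp.coeFn_add f g)).trans ?_
        refine .trans ?_ (Lp.coeFn_add _ _).symm
        filter_upwards [(memLp_modDil ha b c (Lp.memLp f)).coeFn_toLp,
          (memLp_modDil ha b c (Lp.memLp g)).coeFn_toLp] with t h1 h2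
        rw [Pi.add_apply, h1, h2]
        simp only [modDil, Pi.add_apply, mul_add]
      map_smul' := by
        intro z f
        apply Lp.ext
        refine (MemLp.coeFn_toLp _).trans ?_
        refine (modDil_congr_ae ha b c (Lp.coeFn_smul z f)).trans ?_
        refine .trans ?_ (Lp.coeFn_smul _ _).symm
        filter_upwards [(memLp_modDil ha b c (Lp.memLp f)).coeFn_toLp] with t h1
        rw [Pi.smul_apply, RingHom.id_apply, h1]
        simp only [modDil, Pi.smul_apply, smul_eq_mul]
        ring }
    (by
      intro f g
      rw [inner_Lp_eq_integral, inner_Lp_eq_integral]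
      refine Eq.trans ?_ (integral_modDil_mul ha b c f g)
      refine integral_congr_ae ?_
      filter_upwards [(memLp_modDil ha b c (Lp.memLp f)).coeFn_toLp,
          (memLp_modDil ha b c (Lp.memLp g)).coeFn_toLp] with t h1 h2
      simp only [LinearMap.coe_mk, AddHom.coe_mk]
      rw [h1, h2])

theorem coeFn_modDilLp (a b c : ℝ) (ha : 0 < a) (f : Lp ℂ 2 (volume : Measure ℝ)) :
    modDilLp a b c ha f =ᵐ[volume] modDil a b c f :=
  (memLp_modDil ha b c (Lp.memLp f)).coeFn_toLp

theorem modDilLp_toLp (a b c : ℝ) (ha : 0 < a) {f : ℝ → ℂ} (hf : MemLp f 2 volume) :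
    modDilLp a b c ha hf.toLp = (memLp_modDil ha b c hf).toLp := by
  apply Lp.ext
  exact (coeFn_modDilLp a b c ha _).trans
    ((modDil_congr_ae ha b c hf.coeFn_toLp).trans (MemLp.coeFn_toLp _).symm)

/-- On `L¹ ∩ L²`, the Plancherel Fourier transform is given by the Fourier integral. -/
theorem coeFn_fourier_toLp {f : ℝ → ℂ} (hf : MemLp f 2 volume) (hf1 : Integrable f) :
    ((𝓕 hf.toLp : Lp ℂ 2 (volume : Measure ℝ)) : ℝ → ℂ) =ᵐ[volume] 𝓕 f := by
  have hcont : Continuous (𝓕 f) := VectorFourier.fourierIntegral_continuous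
    Real.continuous_fourierChar (by fun_prop) hf1
  refine ae_eq_of_integral_contDiff_smul_eq
    ((Lp.memLp _).locallyIntegrable (by norm_num)) hcont.locallyIntegrable ?_
  intro g hg hgc
  have hgc' : HasCompactSupport (fun x => (g x : ℂ)) :=
    hgc.comp_left (g := fun x : ℝ => (x : ℂ)) rfl
  have hg' : ContDiff ℝ (⊤ : ℕ∞) (fun x => (g x : ℂ)) := Complex.ofRealCLM.contDiff.comp hg
  set s : SchwartzMap ℝ ℂ := hgc'.toSchwartzMap hg' with hs
  -- The L² transform agrees with the distributional one, which is defined by moving the transform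
  -- to the test function. The multiplication formula for integrable functions moves it back onto
  -- `f`.
  have key := congrArg (fun T => T s) (Lp.fourier_toTemperedDistribution_eq hf.toLp)
  simp only [TemperedDistribution.fourier_apply, Lp.toTemperedDistribution_apply] at key
  have e1 : ∀ x, s x = (g x : ℂ) := fun x => rfl
  calc ∫ x, g x • (𝓕 hf.toLp : Lp ℂ 2 (volume : Measure ℝ)) x
      = ∫ x, s x • (𝓕 hf.toLp : Lp ℂ 2 (volume : Measure ℝ)) x := by
        simp only [e1, Complex.real_smul, smul_eq_mul]
    _ = ∫ x, (𝓕 s) x • (hf.toLp f) x := key.symm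
    _ = ∫ x, (𝓕 (s : ℝ → ℂ)) x • f x := by
        refine integral_congr_ae ?_
        filter_upwards [hf.coeFn_toLp] with x hx
        rw [hx, SchwartzMap.fourier_coe]
    _ = ∫ x, s x • 𝓕 f x := by
        have := VectorFourier.integral_fourierIntegral_smul_eq_flip (L := innerₗ ℝ)
          (μ := volume) (ν := volume)
          Real.continuous_fourierChar continuous_inner s.integrable hf1
        simpa using! this
    _ = ∫ x, g x • 𝓕 f x := by
        simp only [e1, Complex.real_smul, smul_eq_mul]

/-- Continuous maps of `L²(ℝ)` that agree on `L¹ ∩ L²` are equal. -/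
theorem eq_of_eq_on_integrable {Y : Type*} [TopologicalSpace Y] [T2Space Y]
    {S T : Lp ℂ 2 (volume : Measure ℝ) → Y} (hS : Continuous S) (hT : Continuous T)
    (h : ∀ (f : ℝ → ℂ) (hf : MemLp f 2 volume), Integrable f → S hf.toLp = T hf.toLp) :
    S = T := by
  refine DenseRange.equalizer (SchwartzMap.denseRange_toLpCLM (E := ℝ) (F := ℂ) (p := 2)
    (μ := volume) ENNReal.ofNat_ne_top) hS hT ?_
  funext s
  exact h s (s.memLp 2 volume) s.integrable

theorem fourier_eq_integral_cis (f : ℝ → ℂ) (x : ℝ) : 𝓕 f x = ∫ t, cis (-(t * x)) * f t := by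
  rw [Real.fourier_real_eq_integral_exp_smul]
  refine integral_congr_ae (.of_forall fun t => ?_)
  simp only [cis, smul_eq_mul]
  congr 3
  push_cast
  ring

/-- The substitution u = a t - b in the Fourier integral. The three parameters of `modDil` are
chosen so that the family contains both sides: translations turn into modulations and a into a⁻¹. -/
theorem fourier_modDil {a : ℝ} (ha : 0 < a) (b : ℝ) (f : ℝ → ℂ) :
    𝓕 (modDil a b 0 f) = modDil a⁻¹ 0 (-(b / a)) (𝓕 f) := by
  funext x
  have ha' : (√a : ℂ) ≠ 0 := by
    exact_mod_cast (Real.sqrt_pos.2 ha).ne'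
  have e1 : ∀ t, cis (-(t * x)) * modDil a b 0 f t =
      (√a : ℂ) * cis (-(b / a) * x) *
        (fun u => cis (-(u * (a⁻¹ * x))) * f u) (a * t - b) := by
    intro t
    have : cis (-(t * x)) = cis (-(b / a) * x) * cis (-((a * t - b) * (a⁻¹ * x))) := by
      rw [← cis_add]
      congr 1
      field_simp
      ring
    simp only [modDil, zero_mul, cis_zero, mul_one, this]
    ring
  rw [fourier_eq_integral_cis]
  simp_rw [e1]
  rw [integral_const_mul, integral_comp_affine ha b (fun u => cis (-(u * (a⁻¹ * x))) * f u), modDil, sub_zero, fourier_eq_integral_cis,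
    Complex.real_smul, Real.sqrt_inv]
  have : (a : ℂ) = √a * √a := by rw [← Complex.ofReal_mul, Real.mul_self_sqrt ha.le]
  push_cast
  rw [this]
  field_simp

/-- The Plancherel transform of `√a f(a t - b)` is `a^{-1/2} e^{-2π i b ξ / a} f̂(ξ / a)`. -/
theorem fourier_modDilLp {a : ℝ} (ha : 0 < a) (b : ℝ) (f : Lp ℂ 2 (volume : Measure ℝ)) :
    𝓕 (modDilLp a b 0 ha f) = modDilLp a⁻¹ 0 (-(b / a)) (inv_pos.2 ha) (𝓕 f) := by
  refine congrFun (eq_of_eq_on_integrable (S := fun f => 𝓕 (modDilLp a b 0 ha f))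
    (T := fun f => modDilLp a⁻¹ 0 (-(b / a)) (inv_pos.2 ha) (𝓕 f)) ?_ ?_ ?_) f
  · exact FourierTransform.continuous_fourier.comp (modDilLp a b 0 ha).continuous
  · exact (modDilLp _ _ _ _).continuous.comp FourierTransform.continuous_fourier
  · intro f hf hf1
    have hint : Integrable (modDil a b 0 f) := by
      have : modDil a b 0 f = fun t => (√a : ℂ) * f (a * t - b) := by
        funext t
        simp [modDil]
      rw [this]
      exact (integrable_comp_affine ha b hf1).const_mul _
    apply Lp.ext
    rw [modDilLp_toLp]
    refine (coeFn_fourier_toLp _ hint).trans ?_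
    rw [fourier_modDil ha]
    exact (modDil_congr_ae (inv_pos.2 ha) _ _ (coeFn_fourier_toLp hf hf1).symm).trans
      (coeFn_modDilLp _ _ _ (inv_pos.2 ha) _).symm

/-- A function in `L¹ ∩ L²` with vanishing Fourier integral is zero. -/
theorem ae_eq_zero_of_fourier_eq_zero {f : ℝ → ℂ} (hf : MemLp f 2 volume) (hf1 : Integrable f)
    (h : ∀ x, 𝓕 f x = 0) : f =ᵐ[volume] 0 := by
  have h1 : (𝓕 hf.toLp : Lp ℂ 2 (volume : Measure ℝ)) = 0 := by
    apply Lp.ext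
    filter_upwards [coeFn_fourier_toLp hf hf1, Lp.coeFn_zero ℂ 2 (volume : Measure ℝ)] with x hx h0
    rw [hx, h x, h0]
    rfl
  have h2 : hf.toLp = 0 := by
    rw [← norm_eq_zero, ← Lp.norm_fourier_eq, h1, norm_zero]
  exact hf.coeFn_toLp.symm.trans (h2 ▸ Lp.coeFn_zero ℂ 2 (volume : Measure ℝ))

/-- If the Plancherel transform of `f` is Hermitian, then `f` is real-valued. -/
theorem ae_im_eq_zero_of_fourier_hermitian (f : Lp ℂ 2 (volume : Measure ℝ))
    (h : ∀ᵐ x, (𝓕 f : Lp ℂ 2 (volume : Measure ℝ)) (-x) =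
      (starRingEnd ℂ) ((𝓕 f : Lp ℂ 2 (volume : Measure ℝ)) x)) :
    ∀ᵐ t, (f t).im = 0 := by
  have hmp : MeasurePreserving (fun x : ℝ => -x) volume volume :=
    Measure.measurePreserving_neg volume
  let J : Lp ℂ 2 (volume : Measure ℝ) → Lp ℂ 2 (volume : Measure ℝ) :=
    (Complex.conjCLE : ℂ →L[ℝ] ℂ).compLp
  have hJ : ∀ g : Lp ℂ 2 (volume : Measure ℝ), J g =ᵐ[volume] fun x => (starRingEnd ℂ) (g x) :=
    fun g => ContinuousLinearMap.coeFn_compLp _ g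
  have hJc : Continuous J :=
    ((Complex.conjCLE : ℂ →L[ℝ] ℂ).compLpL 2 (volume : Measure ℝ)).continuous
  let N : Lp ℂ 2 (volume : Measure ℝ) → Lp ℂ 2 (volume : Measure ℝ) :=
    fun g => Lp.compMeasurePreserving (fun x : ℝ => -x) hmp g
  have hN : ∀ g : Lp ℂ 2 (volume : Measure ℝ), N g =ᵐ[volume] fun x => g (-x) :=
    fun g => Lp.coeFn_compMeasurePreserving g hmp
  have hNc : Continuous N := (Lp.compMeasurePreservingₗᵢ ℂ (fun x : ℝ => -x) hmp
    (E := ℂ) (p := 2)).continuous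
  -- Conjugation before the transform is conjugation and reflection after it. On L¹ ∩ L² this is
  -- conjugation under the integral sign, and continuity extends it to L².
  have key : (fun g : Lp ℂ 2 (volume : Measure ℝ) => (𝓕 (J g) : Lp ℂ 2 (volume : Measure ℝ))) =
      fun g => N (J (𝓕 g)) := by
    refine eq_of_eq_on_integrable (FourierTransform.continuous_fourier.comp hJc)
      (hNc.comp (hJc.comp FourierTransform.continuous_fourier)) ?_
    intro g hg hg1
    have hg' : MemLp (fun x => (starRingEnd ℂ) (g x)) 2 volume := hg.star
    have hg1' : Integrable (fun x => (starRingEnd ℂ) (g x)) :=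
      (Complex.conjCLE : ℂ →L[ℝ] ℂ).integrable_comp hg1
    have hJg : J hg.toLp = hg'.toLp := by
      apply Lp.ext
      refine (hJ _).trans (.trans ?_ hg'.coeFn_toLp.symm)
      filter_upwards [hg.coeFn_toLp] with x hx
      rw [hx]
    rw [hJg]
    apply Lp.ext
    refine (coeFn_fourier_toLp _ hg1').trans (.trans ?_ (hN _).symm)
    filter_upwards [hmp.quasiMeasurePreserving.ae (hJ (𝓕 hg.toLp)),
      hmp.quasiMeasurePreserving.ae (coeFn_fourier_toLp hg hg1)] with x h1 h2
    rw [h1, h2, fourier_eq_integral_cis, fourier_eq_integral_cis, ← integral_conj]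
    refine integral_congr_ae (.of_forall fun t => ?_)
    simp only [map_mul, conj_cis]
    congr 2
    ring
  have h1 : (𝓕 (J f) : Lp ℂ 2 (volume : Measure ℝ)) = 𝓕 f := by
    rw [congrFun key f]
    apply Lp.ext
    refine (hN _).trans ?_
    filter_upwards [hmp.quasiMeasurePreserving.ae (hJ (𝓕 f)), h] with x h2 h3
    rw [h2, h3, Complex.conj_conj]
  have h2 : J f = f := (Lp.fourierTransformₗᵢ ℝ ℂ).injective h1
  filter_upwards [hJ f] with t ht
  rw [h2] at ht
  exact Complex.conj_eq_iff_im.1 ht.symm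

/-! ### The Hilbert space argument for multiresolution analyses. -/

open Submodule in
/-- The wavelets of an abstract multiresolution analysis form a Hilbert basis. -/
theorem exists_hilbertBasis_of_multiresolution {H : Type*} [NormedAddCommGroup H]
    [InnerProductSpace ℂ H] [CompleteSpace H] (φ ψ : ℤ → ℤ → H)
    (hψψ : ∀ j, Orthonormal ℂ (ψ j)) (hφψ : ∀ j k l, inner ℂ (φ j k) (ψ j l) = 0)
    (hφ : ∀ j k, φ j k ∈ span ℂ (Set.range (φ (j + 1))))
    (hψ : ∀ j k, ψ j k ∈ span ℂ (Set.range (φ (j + 1))))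
    (hdec : ∀ j k, φ (j + 1) k ∈ span ℂ (Set.range (φ j)) ⊔ span ℂ (Set.range (ψ j)))
    (hinf : ∀ g, (∀ j, g ∈ (span ℂ (Set.range (φ j))).topologicalClosure) → g = 0)
    (hsup : ∀ f, (∀ j k, inner ℂ (φ j k) f = 0) → f = 0) :
    ∃ b : HilbertBasis (ℤ × ℤ) ℂ H, ∀ i, b i = ψ i.1 i.2 := by
  set V : ℤ → Submodule ℂ H := fun j => span ℂ (Set.range (φ j)) with hV
  have hmono : Monotone V := by
    refine monotone_int_of_le_succ fun j => ?_
    rw [hV, span_le]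
    rintro _ ⟨k, rfl⟩
    exact hφ j k
  have hVψ : ∀ j l, ∀ v ∈ V j, inner ℂ v (ψ j l) = 0 := by
    intro j l v hv
    have : V j ≤ (span ℂ {ψ j l})ᗮ := by
      rw [hV, span_le]
      rintro _ ⟨k, rfl⟩
      rw [SetLike.mem_coe, mem_orthogonal_singleton_iff_inner_left]
      exact hφψ j k l
    exact (mem_orthogonal_singleton_iff_inner_left).1 (this hv)
  have hlt : ∀ j j' k l, j < j' → inner ℂ (ψ j k) (ψ j' l) = 0 := fun j j' k l h =>
    hVψ j' l _ (hmono (Int.add_one_le_iff.2 h) (hψ j k))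
  have hon : Orthonormal ℂ (fun i : ℤ × ℤ => ψ i.1 i.2) := by
    refine ⟨fun i => (hψψ i.1).1 i.2, ?_⟩
    rintro ⟨j, k⟩ ⟨j', l⟩ hne
    rcases lt_trichotomy j j' with h | h | h
    · exact hlt j j' k l h
    · subst h
      exact (hψψ j).2 fun h => hne (Prod.ext rfl h)
    · exact inner_eq_zero_symm.1 (hlt j' j l k h)
  -- Let f be orthogonal to all wavelets. Its projections on the closed scaling spaces turn out not
  -- to depend on j, so their common value lies in every such space and vanishes; then f is
  -- orthogonal to all scaling spaces.
  have hcomp : (span ℂ (Set.range fun i : ℤ × ℤ => ψ i.1 i.2))ᗮ = ⊥ := by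
    rw [eq_bot_iff]
    intro f hf
    have hfψ : ∀ j k, inner ℂ (ψ j k) f = 0 := fun j k =>
      (mem_orthogonal _ _).1 hf _ (subset_span ⟨(j, k), rfl⟩)
    set K : ℤ → Submodule ℂ H := fun j => (V j).topologicalClosure with hK
    have : ∀ j, CompleteSpace (K j) := fun j =>
      (isClosed_topologicalClosure (V j)).completeSpace_coe
    set P : ℤ → H := fun j => (K j).starProjection f with hP
    have hPmem : ∀ j, P j ∈ K j := fun j => starProjection_apply_mem _ _
    have hPinner : ∀ j, ∀ u ∈ K j, inner ℂ u (P j) = inner ℂ u f := by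
      intro j u hu
      have := (mem_orthogonal _ _).1 (sub_starProjection_mem_orthogonal (K := K j) f) u hu
      rw [inner_sub_right, sub_eq_zero] at this
      exact this.symm
    have hKmono : Monotone K := fun i j h => topologicalClosure_mono (hmono h)
    have hVK : ∀ j, V j ≤ K j := fun j => le_topologicalClosure _
    have hψK : ∀ j l, ∀ v ∈ K j, inner ℂ (ψ j l) v = 0 := by
      intro j l v hv
      have : K j ≤ (span ℂ {ψ j l})ᗮ := by
        refine topologicalClosure_minimal _ ?_ (isClosed_orthogonal _)
        intro w hw
        exact (mem_orthogonal_singleton_iff_inner_left).2 (hVψ j l w hw)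
      exact (mem_orthogonal_singleton_iff_inner_right).1 (this hv)
    -- The difference of consecutive projections lies in the finer space and is orthogonal to both
    -- summands that span it, hence to itself.
    have hstep : ∀ j, P (j + 1) = P j := by
      intro j
      set x := P (j + 1) - P j with hx
      have hxmem : x ∈ K (j + 1) :=
        sub_mem (hPmem _) (hKmono (by omega : j ≤ j + 1) (hPmem j))
      have hle : V j ⊔ span ℂ (Set.range (ψ j)) ≤ (span ℂ {x})ᗮ := by
        refine sup_le ?_ (span_le.2 ?_)
        · intro v hv
          rw [mem_orthogonal_singleton_iff_inner_left, hx, inner_sub_right,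
            hPinner (j + 1) v (hVK _ (hmono (by omega : j ≤ j + 1) hv)), hPinner j v (hVK j hv),
            sub_self]
        · rintro _ ⟨l, rfl⟩
          rw [SetLike.mem_coe, mem_orthogonal_singleton_iff_inner_left, hx, inner_sub_right,
            hPinner (j + 1) _ (hVK _ (hψ j l)), hfψ, hψK j l _ (hPmem j), sub_self]
      have hle2 : K (j + 1) ≤ (span ℂ {x})ᗮ := by
        refine topologicalClosure_minimal _ ?_ (isClosed_orthogonal _)
        rw [hV, span_le]
        rintro _ ⟨k, rfl⟩
        exact hle (hdec j k)
      have : inner ℂ x x = 0 := (mem_orthogonal_singleton_iff_inner_left).1 (hle2 hxmem)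
      exact sub_eq_zero.1 (inner_self_eq_zero.1 this)
    have hconst : ∀ j, P j = P 0 := by
      intro j
      induction j using Int.induction_on with
      | zero => rfl
      | succ n ih => rw [hstep, ih]
      | pred n ih => rw [← ih, ← hstep, sub_add_cancel]
    have hP0 : P 0 = 0 := hinf _ fun j => hconst j ▸ hPmem j
    refine (mem_bot ℂ).2 (hsup f fun j k => ?_)
    rw [← hPinner j _ (hVK j (subset_span ⟨k, rfl⟩)), hconst, hP0, inner_zero_right]
  refine ⟨HilbertBasis.mkOfOrthogonalEqBot hon hcomp, fun i => ?_⟩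
  rw [HilbertBasis.coe_mkOfOrthogonalEqBot]

/-! ### Low-pass filters and the infinite product. -/

/-- The `1`-periodic function `ξ ↦ ∑ₙ p(n) e^{-2π i n ξ}`. -/
def lowPass (p : ℝ[X]) (ξ : ℝ) : ℂ := aeval (cis (-ξ)) p

/-- The conditions on a normalized filter which lead to an orthonormal wavelet basis: it is a
conjugate quadrature filter which does not vanish on the middle half of a period. -/
structure IsCohenFilter (p : ℝ[X]) : Prop where
  zero : lowPass p 0 = 1
  qmf : ∀ ξ, ‖lowPass p ξ‖ ^ 2 + ‖lowPass p (ξ + 1 / 2)‖ ^ 2 = 1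
  ne_zero : ∀ ξ, |ξ| ≤ 1 / 4 → lowPass p ξ ≠ 0

/-- The infinite product `∏_{j ≥ 1} m(2^{-j} ξ)`. -/
def scalingHat (p : ℝ[X]) (ξ : ℝ) : ℂ := ∏' j : ℕ, lowPass p (ξ / 2 ^ (j + 1))

theorem lowPass_add_one (p : ℝ[X]) (ξ : ℝ) : lowPass p (ξ + 1) = lowPass p ξ := by
  have h : cis (-(ξ + 1)) = cis (-ξ) := by
    have := cis_int (-1)
    rw [neg_add, cis_add]
    push_cast at this
    rw [this, mul_one]
  rw [lowPass, lowPass, h]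

@[fun_prop]
theorem continuous_lowPass (p : ℝ[X]) : Continuous (lowPass p) := by
  have : lowPass p = fun ξ => (p.map (algebraMap ℝ ℂ)).eval (cis (-ξ)) := by
    funext ξ
    rw [lowPass, eval_map_algebraMap]
  rw [this]
  exact (Polynomial.continuous _).comp (by fun_prop)

theorem lowPass_neg (p : ℝ[X]) (ξ : ℝ) :
    lowPass p (-ξ) = (starRingEnd ℂ) (lowPass p ξ) := by
  rw [lowPass, lowPass, ← conj_cis, ← aeval_conj]

theorem norm_cis_sub_one_le (x : ℝ) : ‖cis x - 1‖ ≤ 2 * Real.pi * |x| := by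
  have := Real.norm_exp_I_mul_ofReal_sub_one_le (x := 2 * Real.pi * x)
  rw [mul_comm Complex.I] at this
  refine this.trans_eq ?_
  rw [Real.norm_eq_abs, abs_mul, abs_of_pos Real.two_pi_pos]

/-- Together with m(0) = 1 this makes m(2^{-j}ξ) - 1 decay geometrically in j, which gives
convergence and continuity of the infinite product. -/
theorem exists_lowPass_lipschitz (p : ℝ[X]) :
    ∃ C, 0 ≤ C ∧ ∀ ξ, ‖lowPass p ξ - lowPass p 0‖ ≤ C * |ξ| := by
  induction p using Polynomial.induction_on' with
  | add p q hp hq =>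
    obtain ⟨C, hC, h⟩ := hp
    obtain ⟨D, hD, h'⟩ := hq
    refine ⟨C + D, by positivity, fun ξ => ?_⟩
    have : lowPass (p + q) ξ - lowPass (p + q) 0 =
        (lowPass p ξ - lowPass p 0) + (lowPass q ξ - lowPass q 0) := by
      simp only [lowPass, map_add]
      ring
    rw [this, add_mul]
    exact (norm_add_le _ _).trans (add_le_add (h ξ) (h' ξ))
  | monomial n a =>
    refine ⟨|a| * (2 * Real.pi * n), by positivity, fun ξ => ?_⟩
    have h1 : lowPass (monomial n a) ξ - lowPass (monomial n a) 0 =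
        (a : ℂ) * (cis ((n : ℤ) * (-ξ)) - 1) := by
      rw [cis_int_mul]
      simp only [lowPass, aeval_monomial, neg_zero, cis_zero, one_pow, zpow_natCast,
        Complex.coe_algebraMap]
      ring
    rw [h1, norm_mul, Complex.norm_real, Real.norm_eq_abs, mul_assoc]
    refine mul_le_mul_of_nonneg_left ((norm_cis_sub_one_le _).trans_eq ?_) (abs_nonneg _)
    rw [abs_mul, abs_neg]
    simp only [Int.cast_natCast, Nat.abs_cast]
    ring

namespace IsCohenFilter

variable {p : ℝ[X]}

theorem norm_le_one (hp : IsCohenFilter p) (ξ : ℝ) : ‖lowPass p ξ‖ ≤ 1 := by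
  have := hp.qmf ξ
  nlinarith [sq_nonneg ‖lowPass p (ξ + 1 / 2)‖, norm_nonneg (lowPass p ξ)]

theorem exists_norm_sub_one_le (hp : IsCohenFilter p) :
    ∃ C, 0 ≤ C ∧ ∀ ξ (j : ℕ), ‖lowPass p (ξ / 2 ^ (j + 1)) - 1‖ ≤ C * |ξ| * (1 / 2) ^ j := by
  obtain ⟨C, hC, h⟩ := exists_lowPass_lipschitz p
  refine ⟨C, hC, fun ξ j => ?_⟩
  have h1 := h (ξ / 2 ^ (j + 1))
  rw [hp.zero] at h1
  refine h1.trans ?_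
  rw [abs_div, abs_of_pos (by positivity : (0 : ℝ) < 2 ^ (j + 1)), mul_assoc]
  refine mul_le_mul_of_nonneg_left ?_ hC
  rw [one_div, inv_pow, ← div_eq_mul_inv]
  exact div_le_div_of_nonneg_left (abs_nonneg _) (by positivity)
    (pow_le_pow_right₀ (by norm_num) (by omega))

theorem summable_norm_sub_one (hp : IsCohenFilter p) (ξ : ℝ) :
    Summable fun j : ℕ => ‖lowPass p (ξ / 2 ^ (j + 1)) - 1‖ := by
  obtain ⟨C, -, h⟩ := hp.exists_norm_sub_one_le
  exact Summable.of_nonneg_of_le (fun _ => norm_nonneg _) (h ξ)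
    (summable_geometric_two.mul_left _)

theorem multipliable (hp : IsCohenFilter p) (ξ : ℝ) :
    Multipliable fun j : ℕ => lowPass p (ξ / 2 ^ (j + 1)) := by
  simpa using multipliable_one_add_of_summable (hp.summable_norm_sub_one ξ)

theorem scalingHat_two_mul (hp : IsCohenFilter p) (ξ : ℝ) :
    scalingHat p (2 * ξ) = lowPass p ξ * scalingHat p ξ := by
  have h1 : ∀ j : ℕ, lowPass p (2 * ξ / 2 ^ (j + 1 + 1)) = lowPass p (ξ / 2 ^ (j + 1)) := by
    intro j
    congr 1
    field_simp
    ring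
  rw [scalingHat, tprod_eq_zero_mul']
  · simp only [h1]
    rw [← scalingHat]
    congr 2
    ring
  · simp only [h1]
    exact hp.multipliable ξ

theorem scalingHat_two_pow_mul (hp : IsCohenFilter p) (n : ℕ) (ξ : ℝ) :
    scalingHat p (2 ^ n * ξ) =
      (∏ j ∈ Finset.range n, lowPass p (2 ^ j * ξ)) * scalingHat p ξ := by
  induction n with
  | zero => simp
  | succ n ih =>
    rw [pow_succ', mul_assoc, hp.scalingHat_two_mul, ih, Finset.prod_range_succ]
    ring

theorem continuous_scalingHat (hp : IsCohenFilter p) : Continuous (scalingHat p) := by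
  obtain ⟨C, hC, h⟩ := hp.exists_norm_sub_one_le
  rw [continuous_iff_continuousAt]
  intro x
  have h1 : ∀ ξ, scalingHat p ξ = ∏' j : ℕ, (1 + (lowPass p (ξ / 2 ^ (j + 1)) - 1)) := by
    intro ξ
    simp [scalingHat]
  rw [ContinuousAt, h1 x, funext h1]
  refine tendsto_tprod_one_add_of_dominated_convergence
    -- Near x one has |ξ| < |x| + 1, so a single summable bound serves a whole neighbourhood.
    (bound := fun j => C * (|x| + 1) * (1 / 2) ^ j) (summable_geometric_two.mul_left _) ?_ ?_
  · intro j
    exact Continuous.tendsto (by fun_prop) x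
  · filter_upwards [(continuous_abs.tendsto x).eventually
      (gt_mem_nhds (lt_add_one |x|))] with ξ hξ j
    refine (h ξ j).trans ?_
    gcongr

theorem scalingHat_zero (hp : IsCohenFilter p) : scalingHat p 0 = 1 := by
  simp [scalingHat, hp.zero]

theorem norm_scalingHat_le_one (hp : IsCohenFilter p) (ξ : ℝ) : ‖scalingHat p ξ‖ ≤ 1 := by
  refine le_of_tendsto (hp.multipliable ξ).hasProd.norm (.of_forall fun s => ?_)
  exact Finset.prod_le_one (fun _ _ => norm_nonneg _) fun _ _ => hp.norm_le_one _

theorem scalingHat_neg (hp : IsCohenFilter p) (ξ : ℝ) :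
    scalingHat p (-ξ) = (starRingEnd ℂ) (scalingHat p ξ) := by
  have h := (hp.multipliable ξ).hasProd.map (starRingEnd ℂ) Complex.continuous_conj
  rw [scalingHat, scalingHat, ← h.tprod_eq]
  refine tprod_congr fun j => ?_
  rw [Function.comp_apply, ← lowPass_neg, neg_div]

/-- Every factor is evaluated at a point of modulus at most 1/4, where m has no zero, and an
absolutely convergent product of nonzero factors is nonzero. -/
theorem scalingHat_ne_zero (hp : IsCohenFilter p) {ξ : ℝ} (hξ : |ξ| ≤ 1 / 2) :
    scalingHat p ξ ≠ 0 := by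
  have h := tprod_one_add_ne_zero_of_summable (f := fun j : ℕ => lowPass p (ξ / 2 ^ (j + 1)) - 1)
    (fun j => ?_) (hp.summable_norm_sub_one ξ)
  · simpa [scalingHat] using h
  · rw [add_sub_cancel]
    refine hp.ne_zero _ ?_
    rw [abs_div, abs_of_pos (by positivity : (0 : ℝ) < 2 ^ (j + 1)), div_le_iff₀ (by positivity)]
    have : (2 : ℝ) ≤ 2 ^ (j + 1) := by
      simpa using pow_le_pow_right₀ (one_le_two (α := ℝ)) (by omega : 1 ≤ j + 1)
    linarith

theorem exists_le_norm_scalingHat (hp : IsCohenFilter p) :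
    ∃ c, 0 < c ∧ ∀ ξ, |ξ| ≤ 1 / 2 → c ≤ ‖scalingHat p ξ‖ := by
  obtain ⟨x, hx, hmin⟩ := (isCompact_Icc (a := -(1 / 2 : ℝ)) (b := 1 / 2)).exists_isMinOn
    ⟨0, by norm_num⟩ hp.continuous_scalingHat.norm.continuousOn
  refine ⟨‖scalingHat p x‖, norm_pos_iff.2 (hp.scalingHat_ne_zero (abs_le.2 hx)), ?_⟩
  intro ξ hξ
  exact hmin (abs_le.1 hξ)

end IsCohenFilter

/-! ### Orthonormality of the integer translates of the father wavelet. -/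

theorem integral_eq_half_of_add_half {T S : ℝ → ℂ} (hT : Continuous T)
    (h : ∀ x, T x + T (x + 1 / 2) = S (2 * x)) :
    ∫ x in (0 : ℝ)..1, T x = (1 / 2 : ℂ) * ∫ x in (0 : ℝ)..1, S x := by
  have h1 : ∫ x in (1 / 2 : ℝ)..1, T x = ∫ x in (0 : ℝ)..(1 / 2), T (x + 1 / 2) := by
    rw [intervalIntegral.integral_comp_add_right]
    norm_num
  rw [← intervalIntegral.integral_add_adjacent_intervals (b := 1 / 2)
    (hT.intervalIntegrable _ _) (hT.intervalIntegrable _ _), h1,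
    ← intervalIntegral.integral_add (hT.intervalIntegrable _ _)
      (Continuous.intervalIntegrable (by fun_prop) _ _)]
  simp_rw [h]
  rw [intervalIntegral.integral_comp_mul_left (fun x => S x) two_ne_zero]
  norm_num

theorem integral_cis_int_mul (k : ℤ) :
    ∫ x in (0 : ℝ)..1, cis (k * x) = if k = 0 then 1 else 0 := by
  split_ifs with hk
  · simp [hk]
  · have hc : (2 * Real.pi * k * Complex.I : ℂ) ≠ 0 := by
      simp [Real.pi_ne_zero, hk]
    have h1 : ∀ x : ℝ, cis (k * x) = Complex.exp ((2 * Real.pi * k * Complex.I : ℂ) * x) := by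
      intro x
      rw [cis]
      congr 1
      push_cast
      ring
    have h2 : Complex.exp (2 * Real.pi * k * Complex.I) = 1 := by
      rw [← Complex.exp_int_mul_two_pi_mul_I k]
      congr 1
      ring
    simp_rw [h1]
    rw [integral_exp_mul_complex hc]
    simp [h2]

/-- The product `∏_{j < n} |m(2^j ξ)|²`. -/
def powerProduct (p : ℝ[X]) (n : ℕ) (ξ : ℝ) : ℝ :=
  ∏ j ∈ Finset.range n, ‖lowPass p (2 ^ j * ξ)‖ ^ 2

@[fun_prop]
theorem continuous_powerProduct (p : ℝ[X]) (n : ℕ) : Continuous (powerProduct p n) := by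
  unfold powerProduct
  fun_prop

theorem powerProduct_nonneg (p : ℝ[X]) (n : ℕ) (ξ : ℝ) : 0 ≤ powerProduct p n ξ :=
  Finset.prod_nonneg fun _ _ => sq_nonneg _

theorem powerProduct_succ (p : ℝ[X]) (n : ℕ) (ξ : ℝ) :
    powerProduct p (n + 1) ξ = ‖lowPass p ξ‖ ^ 2 * powerProduct p n (2 * ξ) := by
  rw [powerProduct, Finset.prod_range_succ', mul_comm, powerProduct]
  simp only [pow_succ, mul_assoc, pow_zero, one_mul]

theorem powerProduct_add_one (p : ℝ[X]) (n : ℕ) (ξ : ℝ) :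
    powerProduct p n (ξ + 1) = powerProduct p n ξ := by
  induction n generalizing ξ with
  | zero => rfl
  | succ n ih =>
    have h : 2 * (ξ + 1) = 2 * ξ + 1 + 1 := by ring
    rw [powerProduct_succ, powerProduct_succ, lowPass_add_one, h, ih, ih]

theorem cis_int_mul_add_one (k : ℤ) (x : ℝ) : cis (k * (x + 1)) = cis (k * x) := by
  rw [mul_add, cis_add, mul_one, cis_int, mul_one]

namespace IsCohenFilter

variable {p : ℝ[X]}

/-- Adding the values of the integrand at x and x + 1/2 removes the factor j = 0 by the quadrature
identity and leaves the integrand for n at 2x. Each induction step therefore halves the integral. -/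
theorem integral_powerProduct_mul_cis (hp : IsCohenFilter p) (n : ℕ) (k : ℤ) :
    ∫ x in (0 : ℝ)..1, (powerProduct p n x : ℂ) * cis ((k * 2 ^ n : ℤ) * x) =
      if k = 0 then (1 / 2 ^ n : ℂ) else 0 := by
  induction n with
  | zero =>
    simp only [powerProduct, Finset.range_zero, Finset.prod_empty, pow_zero, mul_one,
      Complex.ofReal_one, one_mul, div_one]
    exact integral_cis_int_mul k
  | succ n ih =>
    rw [integral_eq_half_of_add_half
      (S := fun x => (powerProduct p n x : ℂ) * cis ((k * 2 ^ n : ℤ) * x))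
      (by fun_prop), ih]
    · split_ifs
      · field_simp
        ring
      · simp
    · intro x
      have h1 : ((k * 2 ^ (n + 1) : ℤ) : ℝ) * x = (k * 2 ^ n : ℤ) * (2 * x) := by
        push_cast
        ring
      have h2 : ((k * 2 ^ (n + 1) : ℤ) : ℝ) * (x + 1 / 2) = (k * 2 ^ n : ℤ) * (2 * x + 1) := by
        push_cast
        ring
      have h3 : 2 * (x + 1 / 2) = 2 * x + 1 := by ring
      rw [h1, h2, powerProduct_succ, powerProduct_succ, cis_int_mul_add_one, h3,
        powerProduct_add_one]
      have h4 := congrArg (fun r : ℝ => (r : ℂ)) (hp.qmf x)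
      push_cast at h4 ⊢
      linear_combination (powerProduct p n (2 * x) : ℂ) * cis (k * 2 ^ n * (2 * x)) * h4

theorem norm_scalingHat_sq (hp : IsCohenFilter p) (n : ℕ) (ξ : ℝ) :
    ‖scalingHat p ξ‖ ^ 2 = powerProduct p n (ξ / 2 ^ n) * ‖scalingHat p (ξ / 2 ^ n)‖ ^ 2 := by
  have h := hp.scalingHat_two_pow_mul n (ξ / 2 ^ n)
  rw [mul_div_cancel₀ _ (by positivity)] at h
  rw [h, norm_mul, mul_pow, norm_prod, powerProduct, Finset.prod_pow]

theorem integral_powerProduct_div_mul_cis (hp : IsCohenFilter p) (n : ℕ) (k : ℤ) :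
    ∫ x in (-(2 ^ n / 2 : ℝ))..(2 ^ n / 2), (powerProduct p n (x / 2 ^ n) : ℂ) * cis (k * x) =
      if k = 0 then (1 : ℂ) else 0 := by
  have h1 : ∀ x : ℝ, (powerProduct p n (x / 2 ^ n) : ℂ) * cis (k * x) =
      (fun x => (powerProduct p n x : ℂ) * cis ((k * 2 ^ n : ℤ) * x)) (x / 2 ^ n) := by
    intro x
    simp only
    congr 2
    push_cast
    field_simp
  simp_rw [h1]
  rw [intervalIntegral.integral_comp_div (c := (2 : ℝ) ^ n)
    (fun x => (powerProduct p n x : ℂ) * cis ((k * 2 ^ n : ℤ) * x)) (by positivity)]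
  have hper : Function.Periodic
      (fun x => (powerProduct p n x : ℂ) * cis ((k * 2 ^ n : ℤ) * x)) 1 := by
    intro x
    simp only
    rw [powerProduct_add_one, cis_int_mul_add_one]
  have h2 := hper.intervalIntegral_add_eq (-(1 / 2)) 0
  rw [zero_add, hp.integral_powerProduct_mul_cis] at h2
  have e1 : -((2 : ℝ) ^ n / 2) / 2 ^ n = -(1 / 2) := by field_simp
  have e2 : ((2 : ℝ) ^ n / 2) / 2 ^ n = -(1 / 2) + 1 := by
    field_simp
    ring
  rw [e1, e2, h2, Complex.real_smul]
  split_ifs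
  · push_cast
    field_simp
  · simp

theorem tendsto_scalingHat_div (hp : IsCohenFilter p) (ξ : ℝ) :
    Tendsto (fun n : ℕ => scalingHat p (ξ / 2 ^ n)) atTop (𝓝 1) := by
  rw [← hp.scalingHat_zero]
  refine (hp.continuous_scalingHat.tendsto 0).comp ?_
  exact tendsto_const_nhds.div_atTop (tendsto_pow_atTop_atTop_of_one_lt one_lt_two)

theorem tendsto_two_pow_half : Tendsto (fun n : ℕ => (2 : ℝ) ^ n / 2) atTop atTop :=
  (tendsto_pow_atTop_atTop_of_one_lt one_lt_two).atTop_div_const two_pos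

/-- Since |Φ| ≤ 1, the finite product dominates |Φ|², and its integral over the growing interval is
exactly 1. -/
theorem integrable_norm_scalingHat_sq (hp : IsCohenFilter p) :
    Integrable fun ξ => ‖scalingHat p ξ‖ ^ 2 := by
  have hc : Continuous fun ξ => ‖scalingHat p ξ‖ ^ 2 := hp.continuous_scalingHat.norm.pow 2
  refine integrable_of_intervalIntegral_norm_bounded (l := atTop)
    (a := fun n : ℕ => -((2 : ℝ) ^ n / 2)) (b := fun n : ℕ => (2 : ℝ) ^ n / 2) 1
    (fun n => hc.integrableOn_Ioc) ?_ ?_ (.of_forall fun n => ?_)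
  · exact tendsto_neg_atTop_atBot.comp tendsto_two_pow_half
  · exact tendsto_two_pow_half
  · have h1 := hp.integral_powerProduct_div_mul_cis n 0
    simp only [Int.cast_zero, zero_mul, cis_zero, mul_one, if_true] at h1
    rw [intervalIntegral.integral_ofReal] at h1
    have h2 : ∫ x in (-(2 ^ n / 2 : ℝ))..(2 ^ n / 2), powerProduct p n (x / 2 ^ n) = 1 := by
      exact_mod_cast h1
    rw [← h2]
    have hpos : (0 : ℝ) < 2 ^ n := by positivity
    refine intervalIntegral.integral_mono_on (by linarith)
      (hc.norm.intervalIntegrable _ _) (Continuous.intervalIntegrable (by fun_prop) _ _) ?_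
    intro x _
    rw [Real.norm_of_nonneg (sq_nonneg _), hp.norm_scalingHat_sq n x]
    refine mul_le_of_le_one_right (powerProduct_nonneg _ _ _) ?_
    exact pow_le_one₀ (norm_nonneg _) (hp.norm_scalingHat_le_one _)

theorem memLp_scalingHat (hp : IsCohenFilter p) : MemLp (scalingHat p) 2 volume :=
  (memLp_two_iff_integrable_sq_norm hp.continuous_scalingHat.aestronglyMeasurable).2
    hp.integrable_norm_scalingHat_sq

/-- The integer translates of the scaling function are orthonormal. -/
theorem integral_norm_scalingHat_sq_mul_cis (hp : IsCohenFilter p) (k : ℤ) :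
    ∫ ξ, ((‖scalingHat p ξ‖ ^ 2 : ℝ) : ℂ) * cis (k * ξ) = if k = 0 then 1 else 0 := by
  obtain ⟨c, hc, hle⟩ := hp.exists_le_norm_scalingHat
  -- On |ξ| ≤ 2^n/2 the finite product equals |Φ(ξ)|²/|Φ(ξ/2^n)|², which is at most c⁻²|Φ(ξ)|². The
  -- zero-free condition on m enters here, through c.
  have hlim : Tendsto (fun n : ℕ => ∫ ξ,
      (Set.Ioc (-(2 ^ n / 2 : ℝ)) (2 ^ n / 2)).indicator
        (fun ξ => (powerProduct p n (ξ / 2 ^ n) : ℂ) * cis (k * ξ)) ξ) atTop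
      (𝓝 (∫ ξ, ((‖scalingHat p ξ‖ ^ 2 : ℝ) : ℂ) * cis (k * ξ))) := by
    refine tendsto_integral_of_dominated_convergence
      (fun ξ => (c ^ 2)⁻¹ * ‖scalingHat p ξ‖ ^ 2) ?_
      (hp.integrable_norm_scalingHat_sq.const_mul _) ?_ ?_
    · intro n
      exact (Continuous.aestronglyMeasurable (by fun_prop)).indicator measurableSet_Ioc
    · refine fun n => .of_forall fun ξ => ?_
      by_cases hξ : ξ ∈ Set.Ioc (-(2 ^ n / 2 : ℝ)) (2 ^ n / 2)
      · rw [Set.indicator_of_mem hξ, norm_mul, norm_cis, mul_one, Complex.norm_real,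
          Real.norm_of_nonneg (powerProduct_nonneg _ _ _), hp.norm_scalingHat_sq n ξ,
          inv_mul_eq_div, le_div_iff₀ (by positivity)]
        refine mul_le_mul_of_nonneg_left ?_ (powerProduct_nonneg _ _ _)
        refine pow_le_pow_left₀ hc.le (hle _ ?_) 2
        have hpos : (0 : ℝ) < 2 ^ n := by positivity
        rw [abs_div, abs_of_pos hpos, div_le_iff₀ hpos, abs_le]
        constructor <;> linarith [hξ.1, hξ.2]
      · rw [Set.indicator_of_notMem hξ, norm_zero]
        positivity
    · refine .of_forall fun ξ => ?_
      have h1 := hp.tendsto_scalingHat_div ξ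
      have h2 : Tendsto (fun n : ℕ => (((‖scalingHat p ξ‖ ^ 2 : ℝ) : ℂ) /
          ((‖scalingHat p (ξ / 2 ^ n)‖ ^ 2 : ℝ) : ℂ)) * cis (k * ξ)) atTop
          (𝓝 (((‖scalingHat p ξ‖ ^ 2 : ℝ) : ℂ) * cis (k * ξ))) := by
        have h3 : Tendsto (fun n : ℕ => ((‖scalingHat p (ξ / 2 ^ n)‖ ^ 2 : ℝ) : ℂ)) atTop
            (𝓝 1) := by
          have := (Complex.continuous_ofReal.tendsto _).comp (h1.norm.pow 2)
          simpa [Function.comp_def] using this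
        simpa using (tendsto_const_nhds.div h3 one_ne_zero).mul_const (cis (k * ξ))
      refine h2.congr' ?_
      filter_upwards [h1.eventually_ne one_ne_zero,
        tendsto_two_pow_half.eventually_gt_atTop |ξ|] with n hn hn2
      have hmem : ξ ∈ Set.Ioc (-(2 ^ n / 2 : ℝ)) (2 ^ n / 2) :=
        ⟨(abs_lt.1 hn2).1, (abs_lt.1 hn2).2.le⟩
      rw [Set.indicator_of_mem hmem, hp.norm_scalingHat_sq n ξ, Complex.ofReal_mul,
        mul_div_cancel_right₀]
      exact_mod_cast pow_ne_zero 2 (norm_ne_zero_iff.2 hn)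
  -- The truncated integrals do not depend on n.
  refine tendsto_nhds_unique hlim (tendsto_const_nhds.congr fun n => ?_)
  have hpos : (0 : ℝ) < 2 ^ n := by positivity
  rw [integral_indicator measurableSet_Ioc, ← intervalIntegral.integral_of_le (by linarith),
    hp.integral_powerProduct_div_mul_cis]

end IsCohenFilter

/-! ### Trigonometric polynomials. -/

/-- Trigonometric polynomials of period one. -/
def trigPoly : Submodule ℂ (ℝ → ℂ) :=
  Submodule.span ℂ (Set.range fun (n : ℤ) (x : ℝ) => cis (n * x))

theorem cis_mem_trigPoly (n : ℤ) : (fun x : ℝ => cis (n * x)) ∈ trigPoly :=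
  Submodule.subset_span ⟨n, rfl⟩

/-- Induction on trigonometric polynomials. -/
theorem trigPoly_induction {P : (T : ℝ → ℂ) → T ∈ trigPoly → Prop}
    (hcis : ∀ n : ℤ, P (fun x => cis (n * x)) (cis_mem_trigPoly n))
    (hadd : ∀ S T (hS : S ∈ trigPoly) (hT : T ∈ trigPoly), P S hS → P T hT →
      P (fun x => S x + T x) (trigPoly.add_mem hS hT))
    (hsmul : ∀ (c : ℂ) T (hT : T ∈ trigPoly), P T hT →
      P (fun x => c * T x) (trigPoly.smul_mem c hT)) {T : ℝ → ℂ}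
    (hT : T ∈ trigPoly) : P T hT := by
  induction hT using Submodule.span_induction with
  | mem _ h => obtain ⟨n, rfl⟩ := h; exact hcis n
  | zero =>
    have := hsmul 0 _ (cis_mem_trigPoly 0) (hcis 0)
    simp only [zero_mul] at this
    exact this
  | add S T hS hT h h' => exact hadd S T hS hT h h'
  | smul c T hT h => exact hsmul c T hT h

theorem mul_mem_trigPoly {S T : ℝ → ℂ} (hS : S ∈ trigPoly) (hT : T ∈ trigPoly) :
    (fun x => S x * T x) ∈ trigPoly := by
  have h : S * T ∈ trigPoly * trigPoly := Submodule.mul_mem_mul hS hT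
  rw [trigPoly, Submodule.span_mul_span] at h
  refine Submodule.span_mono ?_ h
  rintro _ ⟨_, ⟨m, rfl⟩, _, ⟨n, rfl⟩, rfl⟩
  refine ⟨m + n, ?_⟩
  funext x
  simp only [Pi.mul_apply]
  rw [← cis_add]
  congr 1
  push_cast
  ring

theorem const_mem_trigPoly (c : ℂ) : (fun _ : ℝ => c) ∈ trigPoly := by
  have h := trigPoly.smul_mem c (cis_mem_trigPoly 0)
  convert h using 1
  funext x
  simp

theorem conj_mem_trigPoly {T : ℝ → ℂ} (hT : T ∈ trigPoly) :
    (fun x => (starRingEnd ℂ) (T x)) ∈ trigPoly := by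
  induction hT using trigPoly_induction with
  | hcis n =>
    convert cis_mem_trigPoly (-n) using 2 with x
    rw [conj_cis]
    push_cast
    ring_nf
  | hadd S T _ _ h h' =>
    simp only [map_add]
    exact trigPoly.add_mem h h'
  | hsmul c T _ h =>
    simp only [map_mul]
    exact trigPoly.smul_mem _ h

theorem comp_two_mul_mem_trigPoly {T : ℝ → ℂ} (hT : T ∈ trigPoly) :
    (fun x => T (2 * x)) ∈ trigPoly := by
  induction hT using trigPoly_induction with
  | hcis n =>
    convert cis_mem_trigPoly (2 * n) using 3 with x
    push_cast
    ring
  | hadd S T _ _ h h' => exact trigPoly.add_mem h h'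
  | hsmul c T _ h => exact trigPoly.smul_mem _ h

theorem cis_int_mul_add_half (n : ℤ) (x : ℝ) :
    cis (n * (x + 1 / 2)) = (-1) ^ n * cis (n * x) := by
  rw [mul_add, cis_add, cis_int_mul n (1 / 2), cis_half, mul_comm]

theorem comp_add_half_mem_trigPoly {T : ℝ → ℂ} (hT : T ∈ trigPoly) :
    (fun x => T (x + 1 / 2)) ∈ trigPoly := by
  induction hT using trigPoly_induction with
  | hcis n =>
    simp only [cis_int_mul_add_half]
    exact trigPoly.smul_mem _ (cis_mem_trigPoly n)
  | hadd S T _ _ h h' => exact trigPoly.add_mem h h'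
  | hsmul c T _ h => exact trigPoly.smul_mem _ h

/-- Symmetrization over the half period yields a trigonometric polynomial of period `1 / 2`. -/
theorem exists_trigPoly_two_mul {T : ℝ → ℂ} (hT : T ∈ trigPoly) :
    ∃ S ∈ trigPoly, ∀ x, T x + T (x + 1 / 2) = S (2 * x) := by
  induction hT using trigPoly_induction with
  | hcis n =>
    rcases Int.even_or_odd' n with ⟨k, rfl | rfl⟩
    · refine ⟨_, trigPoly.smul_mem (2 : ℂ) (cis_mem_trigPoly k), fun x => ?_⟩
      have h : ((2 * k : ℤ) : ℝ) * x = k * (2 * x) := by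
        push_cast
        ring
      simp only [Pi.smul_apply, smul_eq_mul]
      rw [cis_int_mul_add_half, (even_two_mul k).neg_one_zpow, h]
      ring
    · refine ⟨0, trigPoly.zero_mem, fun x => ?_⟩
      simp only [Pi.zero_apply]
      rw [cis_int_mul_add_half, (odd_two_mul_add_one k).neg_one_zpow]
      ring
  | hadd S T _ _ h h' =>
    obtain ⟨U, hU, h⟩ := h
    obtain ⟨V, hV, h'⟩ := h'
    refine ⟨U + V, trigPoly.add_mem hU hV, fun x => ?_⟩
    rw [Pi.add_apply, ← h, ← h']
    ring
  | hsmul c T _ h =>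
    obtain ⟨U, hU, h⟩ := h
    refine ⟨c • U, trigPoly.smul_mem _ hU, fun x => ?_⟩
    rw [Pi.smul_apply, smul_eq_mul, ← h]
    ring

theorem continuous_of_mem_trigPoly {T : ℝ → ℂ} (hT : T ∈ trigPoly) : Continuous T := by
  induction hT using trigPoly_induction with
  | hcis n => fun_prop
  | hadd S T _ _ h h' => exact h.add h'
  | hsmul c T _ h => exact h.const_mul c

theorem exists_norm_le_of_mem_trigPoly {T : ℝ → ℂ} (hT : T ∈ trigPoly) : ∃ C, ∀ x, ‖T x‖ ≤ C := by
  induction hT using trigPoly_induction with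
  | hcis n => exact ⟨1, fun x => (norm_cis _).le⟩
  | hadd S T _ _ h h' =>
    obtain ⟨C, h⟩ := h
    obtain ⟨D, h'⟩ := h'
    exact ⟨C + D, fun x => (norm_add_le _ _).trans (add_le_add (h x) (h' x))⟩
  | hsmul c T _ h =>
    obtain ⟨C, h⟩ := h
    refine ⟨‖c‖ * C, fun x => ?_⟩
    rw [norm_mul]
    exact mul_le_mul_of_nonneg_left (h x) (norm_nonneg c)

theorem lowPass_mem_trigPoly (p : ℝ[X]) : lowPass p ∈ trigPoly := by
  induction p using Polynomial.induction_on' with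
  | add p q hp hq =>
    have : lowPass (p + q) = lowPass p + lowPass q := by
      funext x
      simp [lowPass]
    rw [this]
    exact trigPoly.add_mem hp hq
  | monomial n a =>
    convert trigPoly.smul_mem (a : ℂ) (cis_mem_trigPoly (-n)) using 1
    funext x
    have : ((-n : ℤ) : ℝ) * x = (n : ℤ) * (-x) := by
      push_cast
      ring
    rw [Pi.smul_apply, this, cis_int_mul]
    simp [lowPass, aeval_monomial]

/-! ### The mother wavelet and its orthogonality relations. -/

/-- The frequency response `e^{-2π i ξ} conj m(ξ + 1/2)` of the high-pass filter. -/
def highResponse (p : ℝ[X]) (ξ : ℝ) : ℂ := cis (-ξ) * (starRingEnd ℂ) (lowPass p (ξ + 1 / 2))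

/-- The Fourier transform of the mother wavelet, as a function of the frequency. -/
def waveletHat (p : ℝ[X]) (ξ : ℝ) : ℂ := highResponse p (ξ / 2) * scalingHat p (ξ / 2)

theorem highResponse_add_half (p : ℝ[X]) (ξ : ℝ) :
    highResponse p (ξ + 1 / 2) = -(cis (-ξ) * (starRingEnd ℂ) (lowPass p ξ)) := by
  have h : ξ + 1 / 2 + 1 / 2 = ξ + 1 := by ring
  have h2 : cis (-(1 / 2)) = -1 := by rw [cis_neg, cis_half, inv_neg, inv_one]
  rw [highResponse, h, lowPass_add_one, neg_add, cis_add, h2]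
  ring

theorem highResponse_mem_trigPoly (p : ℝ[X]) : highResponse p ∈ trigPoly := by
  have h := cis_mem_trigPoly (-1)
  simp only [Int.cast_neg, Int.cast_one, neg_mul, one_mul] at h
  exact mul_mem_trigPoly h
    (conj_mem_trigPoly (comp_add_half_mem_trigPoly (lowPass_mem_trigPoly p)))

theorem waveletHat_two_mul (p : ℝ[X]) (ξ : ℝ) :
    waveletHat p (2 * ξ) = highResponse p ξ * scalingHat p ξ := by
  rw [waveletHat, mul_div_cancel_left₀ _ two_ne_zero]

theorem cis_neg_mul_cis (ξ : ℝ) : cis (-ξ) * cis ξ = 1 := by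
  rw [← cis_add, neg_add_cancel, cis_zero]

namespace IsCohenFilter

variable {p : ℝ[X]}

theorem qmf_complex (hp : IsCohenFilter p) (ξ : ℝ) :
    lowPass p ξ * (starRingEnd ℂ) (lowPass p ξ) +
      lowPass p (ξ + 1 / 2) * (starRingEnd ℂ) (lowPass p (ξ + 1 / 2)) = 1 := by
  rw [Complex.mul_conj', Complex.mul_conj']
  exact_mod_cast hp.qmf ξ

theorem continuous_waveletHat (hp : IsCohenFilter p) : Continuous (waveletHat p) := by
  have h1 := continuous_of_mem_trigPoly (highResponse_mem_trigPoly p)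
  have h2 := hp.continuous_scalingHat
  unfold waveletHat
  fun_prop

theorem integrable_trigPoly_mul (hp : IsCohenFilter p) {T : ℝ → ℂ} (hT : T ∈ trigPoly) :
    Integrable fun ξ => ((‖scalingHat p ξ‖ ^ 2 : ℝ) : ℂ) * T ξ := by
  obtain ⟨C, hC⟩ := exists_norm_le_of_mem_trigPoly hT
  exact hp.integrable_norm_scalingHat_sq.ofReal.mul_bdd
    (continuous_of_mem_trigPoly hT).aestronglyMeasurable (.of_forall hC)

/-- A weak form of the statement that the periodization of |Φ|² is 1, obtained by linearity from the
characters. -/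
theorem integral_trigPoly_mul (hp : IsCohenFilter p) {T : ℝ → ℂ} (hT : T ∈ trigPoly) :
    ∫ ξ, ((‖scalingHat p ξ‖ ^ 2 : ℝ) : ℂ) * T ξ = ∫ x in (0 : ℝ)..1, T x := by
  induction hT using trigPoly_induction with
  | hcis n => rw [hp.integral_norm_scalingHat_sq_mul_cis, integral_cis_int_mul]
  | hadd S T hS hT h h' =>
    simp only [mul_add]
    rw [integral_add (hp.integrable_trigPoly_mul hS) (hp.integrable_trigPoly_mul hT), h, h',
      intervalIntegral.integral_add ((continuous_of_mem_trigPoly hS).intervalIntegrable _ _)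
        ((continuous_of_mem_trigPoly hT).intervalIntegrable _ _)]
  | hsmul c T _ h =>
    simp only [mul_left_comm _ c]
    rw [integral_const_mul, h, intervalIntegral.integral_const_mul]

theorem memLp_waveletHat (hp : IsCohenFilter p) : MemLp (waveletHat p) 2 volume := by
  rw [memLp_two_iff_integrable_sq_norm hp.continuous_waveletHat.aestronglyMeasurable]
  obtain ⟨C, hC⟩ := exists_norm_le_of_mem_trigPoly (highResponse_mem_trigPoly p)
  have h1 : Integrable fun ξ => ‖highResponse p ξ‖ ^ 2 * ‖scalingHat p ξ‖ ^ 2 := by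
    refine hp.integrable_norm_scalingHat_sq.bdd_mul (c := C ^ 2)
      ((continuous_of_mem_trigPoly
        (highResponse_mem_trigPoly p)).norm.pow 2).aestronglyMeasurable ?_
    refine .of_forall fun ξ => ?_
    rw [norm_pow, norm_norm]
    exact pow_le_pow_left₀ (norm_nonneg _) (hC ξ) 2
  refine (h1.comp_div two_ne_zero).congr (.of_forall fun ξ => ?_)
  simp only [waveletHat, norm_mul, mul_pow]

/-- Pairing `U(ξ/2) Φ(ξ/2)` with `V(ξ/2) Φ(ξ/2)` for a trigonometric polynomial `T = conj U * V`
reduces to the half-period symmetrization of `T`. -/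
theorem integral_cis_mul_half (hp : IsCohenFilter p) {T : ℝ → ℂ} (hT : T ∈ trigPoly) (n : ℤ)
    (c : ℂ) (h : ∀ x, T x + T (x + 1 / 2) = c) :
    ∫ ξ, cis (n * ξ) * (((‖scalingHat p (ξ / 2)‖ ^ 2 : ℝ) : ℂ) * T (ξ / 2)) =
      if n = 0 then c else 0 := by
  -- With ξ = 2x the frequency n becomes 2n, and an even frequency is unchanged by the shift x +
  -- 1/2.
  have hmem : (fun x => cis ((2 * n : ℤ) * x) * T x) ∈ trigPoly :=
    mul_mem_trigPoly (cis_mem_trigPoly (2 * n)) hT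
  have h1 : ∀ ξ : ℝ, cis (n * ξ) * (((‖scalingHat p (ξ / 2)‖ ^ 2 : ℝ) : ℂ) * T (ξ / 2)) =
      (fun x => ((‖scalingHat p x‖ ^ 2 : ℝ) : ℂ) * (cis ((2 * n : ℤ) * x) * T x)) (ξ / 2) := by
    intro ξ
    have : ((2 * n : ℤ) : ℝ) * (ξ / 2) = n * ξ := by
      push_cast
      ring
    simp only [this]
    ring
  simp_rw [h1]
  rw [Measure.integral_comp_div
      (fun x => ((‖scalingHat p x‖ ^ 2 : ℝ) : ℂ) * (cis ((2 * n : ℤ) * x) * T x)) 2,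
    hp.integral_trigPoly_mul hmem,
    integral_eq_half_of_add_half (S := fun x => c * cis (n * x))
      (continuous_of_mem_trigPoly hmem),
    intervalIntegral.integral_const_mul, integral_cis_int_mul]
  · split_ifs <;> simp
  · intro x
    have : ((2 * n : ℤ) : ℝ) * x = n * (2 * x) := by
      push_cast
      ring
    rw [cis_int_mul_add_half, (even_two_mul n).neg_one_zpow, ← h x, this]
    ring

/-- The response m₁ satisfies the same quadrature identity as m. -/
theorem integral_cis_mul_waveletHat (hp : IsCohenFilter p) (n : ℤ) :
    ∫ ξ, cis (n * ξ) * ((starRingEnd ℂ) (waveletHat p ξ) * waveletHat p ξ) =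
      if n = 0 then 1 else 0 := by
  have hmem := mul_mem_trigPoly (conj_mem_trigPoly (highResponse_mem_trigPoly p))
    (highResponse_mem_trigPoly p)
  rw [← hp.integral_cis_mul_half hmem n 1]
  · refine integral_congr_ae (.of_forall fun ξ => ?_)
    simp only [waveletHat, map_mul, Complex.ofReal_pow, ← Complex.conj_mul']
    ring
  · intro x
    rw [highResponse_add_half, highResponse]
    simp only [map_mul, map_neg, Complex.conj_conj, conj_cis, neg_neg]
    linear_combination (cis x * cis (-x)) * hp.qmf_complex x + cis_neg_mul_cis x

/-- The factor e^{-2πiξ} of m₁ changes sign under the shift by 1/2, so the two terms of the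
symmetrization of conj(m) m₁ cancel. -/
theorem integral_cis_mul_scalingHat_waveletHat (hp : IsCohenFilter p) (n : ℤ) :
    ∫ ξ, cis (n * ξ) * ((starRingEnd ℂ) (scalingHat p ξ) * waveletHat p ξ) = 0 := by
  have hmem := mul_mem_trigPoly (conj_mem_trigPoly (lowPass_mem_trigPoly p))
    (highResponse_mem_trigPoly p)
  have h := hp.integral_cis_mul_half hmem n 0 ?_
  · rw [ite_self] at h
    rw [← h]
    refine integral_congr_ae (.of_forall fun ξ => ?_)
    have h2 := hp.scalingHat_two_mul (ξ / 2)
    rw [mul_div_cancel₀ _ two_ne_zero] at h2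
    simp only [h2, waveletHat, map_mul, Complex.ofReal_pow, ← Complex.conj_mul']
    ring
  · intro x
    rw [highResponse_add_half, highResponse]
    ring

end IsCohenFilter

/-! ### Scaling and wavelet spaces in L²(ℝ), and density of their union. -/

/-- The Fourier transform of a square integrable function as a function on the real line. -/
def fourierFun (f : Lp ℂ 2 (volume : Measure ℝ)) : ℝ → ℂ := (𝓕 f : Lp ℂ 2 (volume : Measure ℝ))

theorem eq_of_fourierFun_ae_eq {f g : Lp ℂ 2 (volume : Measure ℝ)}
    (h : fourierFun f =ᵐ[volume] fourierFun g) : f = g :=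
  (Lp.fourierTransformₗᵢ ℝ ℂ).injective (Lp.ext h)

theorem fourierFun_add (f g : Lp ℂ 2 (volume : Measure ℝ)) :
    fourierFun (f + g) =ᵐ[volume] fourierFun f + fourierFun g := by
  rw [fourierFun, FourierTransform.fourier_add]
  exact Lp.coeFn_add _ _

theorem fourierFun_smul (c : ℂ) (f : Lp ℂ 2 (volume : Measure ℝ)) :
    fourierFun (c • f) =ᵐ[volume] c • fourierFun f := by
  rw [fourierFun, FourierTransform.fourier_smul]
  exact Lp.coeFn_smul _ _

theorem inner_eq_integral_fourierFun (f g : Lp ℂ 2 (volume : Measure ℝ)) :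
    inner ℂ f g = ∫ ξ, (starRingEnd ℂ) (fourierFun f ξ) * fourierFun g ξ := by
  rw [← Lp.inner_fourier_eq, inner_Lp_eq_integral]
  rfl

theorem two_zpow_pos (j : ℤ) : (0 : ℝ) < 2 ^ j := by positivity

/-- The function `2^{j/2} f(2^j t - k)`. -/
def atom (f : Lp ℂ 2 (volume : Measure ℝ)) (j k : ℤ) : Lp ℂ 2 (volume : Measure ℝ) :=
  modDilLp (2 ^ j) k 0 (two_zpow_pos j) f

theorem fourierFun_atom {f : Lp ℂ 2 (volume : Measure ℝ)} {F : ℝ → ℂ}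
    (hf : fourierFun f =ᵐ[volume] F) (j k : ℤ) :
    fourierFun (atom f j k) =ᵐ[volume] fun ξ =>
      (√(2 ^ j)⁻¹ : ℂ) * cis (-k * (ξ / 2 ^ j)) * F (ξ / 2 ^ j) := by
  rw [fourierFun, atom, fourier_modDilLp]
  refine (coeFn_modDilLp _ _ _ (inv_pos.2 (two_zpow_pos j)) _).trans
    ((modDil_congr_ae (inv_pos.2 (two_zpow_pos j)) _ _ hf).trans (.of_forall fun ξ => ?_))
  simp only [modDil, sub_zero]
  rw [inv_mul_eq_div]
  congr 3
  ring

theorem inner_atom {f g : Lp ℂ 2 (volume : Measure ℝ)} {F G : ℝ → ℂ}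
    (hf : fourierFun f =ᵐ[volume] F) (hg : fourierFun g =ᵐ[volume] G) (j k l : ℤ) :
    inner ℂ (atom f j k) (atom g j l) =
      ∫ ξ, cis ((k - l : ℤ) * ξ) * ((starRingEnd ℂ) (F ξ) * G ξ) := by
  rw [inner_eq_integral_fourierFun]
  have h1 : (√(2 ^ j)⁻¹ : ℂ) * (√(2 ^ j)⁻¹ : ℂ) = ((2 ^ j)⁻¹ : ℝ) := by
    rw [← Complex.ofReal_mul, Real.mul_self_sqrt (inv_nonneg.2 (two_zpow_pos j).le)]
  have h2 : (fun ξ => (starRingEnd ℂ) (fourierFun (atom f j k) ξ) * fourierFun (atom g j l) ξ)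
      =ᵐ[volume] fun ξ => (((2 ^ j)⁻¹ : ℝ) : ℂ) *
        (fun ξ => cis ((k - l : ℤ) * ξ) * ((starRingEnd ℂ) (F ξ) * G ξ)) (ξ / 2 ^ j) := by
    filter_upwards [fourierFun_atom hf j k, fourierFun_atom hg j l] with ξ e1 e2
    have h3 : cis ((k - l : ℤ) * (ξ / 2 ^ j)) =
        cis (-(-k * (ξ / 2 ^ j))) * cis (-l * (ξ / 2 ^ j)) := by
      rw [← cis_add]
      congr 1
      push_cast
      ring
    rw [e1, e2, h3, ← h1]
    simp only [map_mul, conj_cis, Complex.conj_ofReal]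
    ring
  rw [integral_congr_ae h2, integral_const_mul, Measure.integral_comp_div
    (fun ξ => cis ((k - l : ℤ) * ξ) * ((starRingEnd ℂ) (F ξ) * G ξ)),
    abs_of_pos (two_zpow_pos j), Complex.real_smul, ← mul_assoc, ← Complex.ofReal_mul,
    inv_mul_cancel₀ (two_zpow_pos j).ne', Complex.ofReal_one, one_mul]

/-- Trigonometric polynomials realize the finite linear combinations of translates. -/
theorem exists_mem_span_atom {f : Lp ℂ 2 (volume : Measure ℝ)} {F : ℝ → ℂ}
    (hf : fourierFun f =ᵐ[volume] F) (j : ℤ) {T : ℝ → ℂ} (hT : T ∈ trigPoly) :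
    ∃ y ∈ Submodule.span ℂ (Set.range (atom f j)),
      fourierFun y =ᵐ[volume] fun ξ => T (ξ / 2 ^ j) * F (ξ / 2 ^ j) := by
  induction hT using trigPoly_induction with
  | hcis n =>
    refine ⟨((√(2 ^ j)⁻¹ : ℂ)⁻¹) • atom f j (-n),
      Submodule.smul_mem _ _ (Submodule.subset_span ⟨-n, rfl⟩), ?_⟩
    have h0 : (√(2 ^ j)⁻¹ : ℂ) ≠ 0 := by
      exact_mod_cast (Real.sqrt_pos.2 (inv_pos.2 (two_zpow_pos j))).ne'
    filter_upwards [fourierFun_smul ((√(2 ^ j)⁻¹ : ℂ)⁻¹) (atom f j (-n)),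
      fourierFun_atom hf j (-n)] with ξ h1 h2
    rw [h1, Pi.smul_apply, h2, smul_eq_mul, mul_assoc, inv_mul_cancel_left₀ h0]
    push_cast
    rw [neg_neg]
  | hadd S T _ _ h h' =>
    obtain ⟨y, hy, h⟩ := h
    obtain ⟨z, hz, h'⟩ := h'
    refine ⟨y + z, Submodule.add_mem _ hy hz, ?_⟩
    filter_upwards [fourierFun_add y z, h, h'] with ξ h1 h2 h3
    rw [h1, Pi.add_apply, h2, h3]
    ring
  | hsmul c T _ h =>
    obtain ⟨y, hy, h⟩ := h
    refine ⟨c • y, Submodule.smul_mem _ _ hy, ?_⟩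
    filter_upwards [fourierFun_smul c y, h] with ξ h1 h2
    rw [h1, Pi.smul_apply, h2, smul_eq_mul]
    ring

theorem mem_span_atom {f x : Lp ℂ 2 (volume : Measure ℝ)} {F : ℝ → ℂ}
    (hf : fourierFun f =ᵐ[volume] F) {j : ℤ} {T : ℝ → ℂ} (hT : T ∈ trigPoly)
    (hx : fourierFun x =ᵐ[volume] fun ξ => T (ξ / 2 ^ j) * F (ξ / 2 ^ j)) :
    x ∈ Submodule.span ℂ (Set.range (atom f j)) := by
  obtain ⟨y, hy, h⟩ := exists_mem_span_atom hf j hT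
  rwa [eq_of_fourierFun_ae_eq (hx.trans h.symm)]

theorem div_two_zpow_eq (ξ : ℝ) (j : ℤ) : ξ / 2 ^ j = 2 * (ξ / 2 ^ (j + 1)) := by
  rw [zpow_add_one₀ two_ne_zero]
  field_simp

theorem cis_neg_int_mem_trigPoly (k : ℤ) : (fun x : ℝ => cis (-k * x)) ∈ trigPoly := by
  simpa using cis_mem_trigPoly (-k)

/-- A function `g` with `ĝ(2ξ) = U(ξ) f̂(ξ)` lies in the next finer space of `f`. -/
theorem atom_mem_span_succ {f g : Lp ℂ 2 (volume : Measure ℝ)} {F G U : ℝ → ℂ}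
    (hf : fourierFun f =ᵐ[volume] F) (hg : fourierFun g =ᵐ[volume] G) (hU : U ∈ trigPoly)
    (h : ∀ ξ, G (2 * ξ) = U ξ * F ξ) (j k : ℤ) :
    atom g j k ∈ Submodule.span ℂ (Set.range (atom f (j + 1))) := by
  refine mem_span_atom hf (mul_mem_trigPoly (const_mem_trigPoly (√(2 ^ j)⁻¹ : ℂ))
    (mul_mem_trigPoly (comp_two_mul_mem_trigPoly (cis_neg_int_mem_trigPoly k)) hU)) ?_
  filter_upwards [fourierFun_atom hg j k] with ξ h1
  rw [h1, div_two_zpow_eq, h]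
  ring

namespace IsCohenFilter

variable {p : ℝ[X]} {φ ψ : Lp ℂ 2 (volume : Measure ℝ)}

theorem orthonormal_scaling (hp : IsCohenFilter p) (hφ : fourierFun φ =ᵐ[volume] scalingHat p)
    (j : ℤ) : Orthonormal ℂ (atom φ j) := by
  rw [orthonormal_iff_ite]
  intro k l
  rw [inner_atom hφ hφ]
  have h := hp.integral_norm_scalingHat_sq_mul_cis (k - l)
  simp only [sub_eq_zero] at h
  rw [← h]
  refine integral_congr_ae (.of_forall fun ξ => ?_)
  simp only [Complex.conj_mul', Complex.ofReal_pow]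
  ring

theorem orthonormal_wavelet (hp : IsCohenFilter p) (hψ : fourierFun ψ =ᵐ[volume] waveletHat p)
    (j : ℤ) : Orthonormal ℂ (atom ψ j) := by
  rw [orthonormal_iff_ite]
  intro k l
  rw [inner_atom hψ hψ, hp.integral_cis_mul_waveletHat]
  simp only [sub_eq_zero]

theorem inner_scaling_wavelet (hp : IsCohenFilter p) (hφ : fourierFun φ =ᵐ[volume] scalingHat p)
    (hψ : fourierFun ψ =ᵐ[volume] waveletHat p) (j k l : ℤ) :
    inner ℂ (atom φ j k) (atom ψ j l) = 0 := by
  rw [inner_atom hφ hψ, hp.integral_cis_mul_scalingHat_waveletHat]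

/-- Write e for e^{-2πikη}. Analysis and synthesis with m and m₁ return eΦ(η): its coefficient is
|m|² + |m₁|² = 1, and the aliased term, at η + 1/2, has coefficient m(η) conj m(η+1/2) + m₁(η) conj
m₁(η+1/2) = 0. -/
theorem scaling_mem_sup (hp : IsCohenFilter p) (hφ : fourierFun φ =ᵐ[volume] scalingHat p)
    (hψ : fourierFun ψ =ᵐ[volume] waveletHat p) (j k : ℤ) :
    atom φ (j + 1) k ∈ Submodule.span ℂ (Set.range (atom φ j)) ⊔
      Submodule.span ℂ (Set.range (atom ψ j)) := by
  obtain ⟨S, hS, h1⟩ := exists_trigPoly_two_mul (mul_mem_trigPoly (cis_neg_int_mem_trigPoly k)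
    (conj_mem_trigPoly (lowPass_mem_trigPoly p)))
  obtain ⟨T, hT, h2⟩ := exists_trigPoly_two_mul (mul_mem_trigPoly (cis_neg_int_mem_trigPoly k)
    (conj_mem_trigPoly (highResponse_mem_trigPoly p)))
  obtain ⟨y, hy, e1⟩ := exists_mem_span_atom hφ j hS
  obtain ⟨z, hz, e2⟩ := exists_mem_span_atom hψ j hT
  have key : atom φ (j + 1) k = (√(2 ^ (j + 1))⁻¹ : ℂ) • (y + z) := by
    refine eq_of_fourierFun_ae_eq ?_
    filter_upwards [fourierFun_atom hφ (j + 1) k, fourierFun_smul (√(2 ^ (j + 1))⁻¹ : ℂ) (y + z),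
      fourierFun_add y z, e1, e2] with ξ a1 a2 a3 a4 a5
    rw [a1, a2, Pi.smul_apply, a3, Pi.add_apply, a4, a5, div_two_zpow_eq ξ j, ← h1, ← h2,
      hp.scalingHat_two_mul, waveletHat_two_mul, highResponse_add_half, highResponse, smul_eq_mul]
    generalize ξ / 2 ^ (j + 1) = η
    have q := hp.qmf_complex η
    have c := cis_neg_mul_cis η
    simp only [map_mul, map_neg, Complex.conj_conj, conj_cis, neg_neg]
    linear_combination (-(√(2 ^ (j + 1))⁻¹ : ℂ) * scalingHat p η) *
      (cis (-k * η) * q + (cis (-k * η) * lowPass p (η + 1 / 2) *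
        (starRingEnd ℂ) (lowPass p (η + 1 / 2)) - cis (-k * (η + 1 / 2)) * lowPass p η *
        (starRingEnd ℂ) (lowPass p (η + 1 / 2))) * c)
  rw [key]
  exact Submodule.smul_mem _ _ (Submodule.add_mem_sup hy hz)

/-- Expresses a coarse scaling function through one that is n levels finer, so that one fixed
Φ(ξ/2^n) can be tested in all finer spaces. -/
theorem exists_scalingHat_two_pow_mul (hp : IsCohenFilter p) (n : ℕ) :
    ∃ T ∈ trigPoly, ∀ ξ, scalingHat p (2 ^ n * ξ) = T ξ * scalingHat p ξ := by
  induction n with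
  | zero => exact ⟨fun _ => 1, const_mem_trigPoly 1, fun ξ => by simp⟩
  | succ n ih =>
    obtain ⟨T, hT, h⟩ := ih
    refine ⟨_, mul_mem_trigPoly (comp_two_mul_mem_trigPoly hT) (lowPass_mem_trigPoly p),
      fun ξ => ?_⟩
    rw [pow_succ, mul_assoc, h, hp.scalingHat_two_mul, mul_assoc]

theorem tendsto_floor_dyadic (x : ℝ) :
    Tendsto (fun n : ℕ => (⌊2 ^ n * x⌋ : ℝ) / 2 ^ n) atTop (𝓝 x) := by
  have h1 : Tendsto (fun n : ℕ => x - 1 / (2 : ℝ) ^ n) atTop (𝓝 x) := by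
    have := (tendsto_const_nhds (x := (1 : ℝ))).div_atTop
      (tendsto_pow_atTop_atTop_of_one_lt (one_lt_two (α := ℝ)))
    simpa using this.const_sub x
  refine tendsto_of_tendsto_of_tendsto_of_le_of_le h1 tendsto_const_nhds ?_ ?_
  · intro n
    have hpos : (0 : ℝ) < 2 ^ n := by positivity
    have := (Int.sub_one_lt_floor ((2 : ℝ) ^ n * x)).le
    simp only
    rw [le_div_iff₀ hpos, sub_mul, one_div, inv_mul_cancel₀ hpos.ne']
    linarith
  · intro n
    have hpos : (0 : ℝ) < 2 ^ n := by positivity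
    have := Int.floor_le ((2 : ℝ) ^ n * x)
    simp only
    rw [div_le_iff₀ hpos]
    linarith

/-- The scaling spaces have dense union. -/
theorem eq_zero_of_inner_scaling (hp : IsCohenFilter p)
    (hφ : fourierFun φ =ᵐ[volume] scalingHat p) (f : Lp ℂ 2 (volume : Measure ℝ))
    (h : ∀ j k, inner ℂ (atom φ j k) f = 0) : f = 0 := by
  have hspan : ∀ j, ∀ y ∈ Submodule.span ℂ (Set.range (atom φ j)), inner ℂ y f = 0 := by
    intro j y hy
    induction hy using Submodule.span_induction with
    | mem _ hx => obtain ⟨k, rfl⟩ := hx; exact h j k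
    | zero => exact inner_zero_left _
    | add x y _ _ hx hy => rw [inner_add_left, hx, hy, add_zero]
    | smul c x _ hx => rw [inner_smul_left, hx, mul_zero]
  have hF : MemLp (fourierFun f) 2 volume := Lp.memLp _
  -- The Fourier integral of conj(Φ(ξ/2^n)) f̂(ξ) at a dyadic point k/2^N with N ≥ n is the inner
  -- product of f with an element of the N-th scaling space, hence 0. Dyadic points are dense and
  -- the integral is continuous in its frequency, so the product vanishes almost everywhere.
  have hprod : ∀ n : ℕ,
      (fun ξ => (starRingEnd ℂ) (scalingHat p (ξ / 2 ^ n)) * fourierFun f ξ) =ᵐ[volume] 0 := by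
    intro n
    have hc : Continuous fun ξ : ℝ => (starRingEnd ℂ) (scalingHat p (ξ / 2 ^ n)) :=
      Complex.continuous_conj.comp (hp.continuous_scalingHat.comp (by fun_prop))
    have hΦ : MemLp (fun ξ : ℝ => (starRingEnd ℂ) (scalingHat p (ξ / 2 ^ n))) 2 volume := by
      rw [memLp_two_iff_integrable_sq_norm hc.aestronglyMeasurable]
      simp only [RCLike.norm_conj]
      exact hp.integrable_norm_scalingHat_sq.comp_div (by positivity)
    have h1 : Integrable fun ξ => (starRingEnd ℂ) (scalingHat p (ξ / 2 ^ n)) * fourierFun f ξ :=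
      hΦ.integrable_mul hF
    have h2 : MemLp (fun ξ => (starRingEnd ℂ) (scalingHat p (ξ / 2 ^ n)) * fourierFun f ξ) 2
        volume := by
      refine hF.of_le_mul (c := 1) h1.1 (.of_forall fun ξ => ?_)
      rw [norm_mul, RCLike.norm_conj]
      exact mul_le_mul_of_nonneg_right (hp.norm_scalingHat_le_one _) (norm_nonneg _)
    refine ae_eq_zero_of_fourier_eq_zero h2 h1 fun x => ?_
    have hcont : Continuous (𝓕 fun ξ =>
        (starRingEnd ℂ) (scalingHat p (ξ / 2 ^ n)) * fourierFun f ξ) :=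
      VectorFourier.fourierIntegral_continuous Real.continuous_fourierChar (by fun_prop) h1
    refine tendsto_nhds_unique ((hcont.tendsto x).comp (tendsto_floor_dyadic x))
      (tendsto_const_nhds.congr' ?_)
    filter_upwards [eventually_ge_atTop n] with N hN
    obtain ⟨d, rfl⟩ := Nat.exists_eq_add_of_le hN
    obtain ⟨T, hT, hTΦ⟩ := hp.exists_scalingHat_two_pow_mul d
    obtain ⟨k, hk⟩ : ∃ k, ⌊2 ^ (n + d) * x⌋ = k := ⟨_, rfl⟩
    obtain ⟨y, hy, e1⟩ := exists_mem_span_atom hφ ((n + d : ℕ) : ℤ)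
      (mul_mem_trigPoly (cis_mem_trigPoly k) hT)
    have e2 := hspan _ y hy
    rw [inner_eq_integral_fourierFun] at e2
    rw [Function.comp_apply, fourier_eq_integral_cis, ← e2, hk]
    refine integral_congr_ae ?_
    filter_upwards [e1] with ξ e3
    have e4 : scalingHat p (ξ / 2 ^ n) = T (ξ / 2 ^ (n + d)) * scalingHat p (ξ / 2 ^ (n + d)) := by
      rw [← hTΦ]
      congr 1
      rw [pow_add]
      field_simp
    have e5 : -((k : ℝ) * (ξ / 2 ^ (n + d))) = -(ξ * (k / 2 ^ (n + d))) := by ring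
    rw [e3, e4]
    simp only [zpow_natCast, map_mul, conj_cis, e5]
    ring
  refine eq_of_fourierFun_ae_eq ?_
  have h0 : fourierFun 0 =ᵐ[volume] 0 := by
    have := fourierFun_smul 0 (0 : Lp ℂ 2 (volume : Measure ℝ))
    simpa using this
  refine .trans ?_ h0.symm
  filter_upwards [ae_all_iff.2 hprod] with ξ hξ
  -- Φ(ξ/2^n) tends to 1, so some n allows division by it.
  obtain ⟨n, hn⟩ := ((hp.tendsto_scalingHat_div ξ).eventually_ne one_ne_zero).exists
  exact (mul_eq_zero.1 (hξ n)).resolve_left ((_root_.map_ne_zero _).2 hn)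

end IsCohenFilter

/-! ### Triviality of the intersection of the scaling spaces. -/

/-- A vector whose coefficients along an orthonormal family have square sum at most `E` pairs with
the closed span of the family with norm at most `√E`. -/
theorem norm_inner_le_of_mem_closure_span {H ι : Type*} [NormedAddCommGroup H]
    [InnerProductSpace ℂ H] {v : ι → H} (hv : Orthonormal ℂ v) (f : H) {E : ℝ}
    (hE : ∀ s : Finset ι, ∑ k ∈ s, ‖inner ℂ (v k) f‖ ^ 2 ≤ E) {x : H}
    (hx : x ∈ (Submodule.span ℂ (Set.range v)).topologicalClosure) :
    ‖inner ℂ x f‖ ≤ ‖x‖ * √E := by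
  have hclosed : IsClosed {y : H | ‖inner ℂ y f‖ ≤ ‖y‖ * √E} :=
    isClosed_le (by fun_prop) (by fun_prop)
  refine closure_minimal ?_ hclosed hx
  intro y hy
  obtain ⟨c, rfl⟩ := Finsupp.mem_span_range_iff_exists_finsupp.1 hy
  have hnorm : ‖c.sum fun i a => a • v i‖ = √(∑ k ∈ c.support, ‖c k‖ ^ 2) := by
    rw [norm_eq_sqrt_re_inner (𝕜 := ℂ), Finsupp.sum, hv.inner_sum]
    congr 1
    rw [map_sum]
    refine Finset.sum_congr rfl fun k _ => ?_
    rw [Complex.conj_mul', ← Complex.ofReal_pow]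
    exact Complex.ofReal_re _
  rw [Set.mem_ofPred_eq, hnorm, Finsupp.sum, sum_inner]
  calc ‖∑ k ∈ c.support, inner ℂ (c k • v k) f‖
      ≤ ∑ k ∈ c.support, ‖c k‖ * ‖inner ℂ (v k) f‖ := by
        refine (norm_sum_le _ _).trans_eq (Finset.sum_congr rfl fun k _ => ?_)
        rw [inner_smul_left, norm_mul, RCLike.norm_conj]
    _ ≤ √(∑ k ∈ c.support, ‖c k‖ ^ 2) * √(∑ k ∈ c.support, ‖inner ℂ (v k) f‖ ^ 2) :=
        Real.sum_mul_le_sqrt_mul_sqrt _ _ _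
    _ ≤ _ := by gcongr; exact hE _

theorem norm_sq_eq_integral (f : Lp ℂ 2 (volume : Measure ℝ)) : ‖f‖ ^ 2 = ∫ t, ‖f t‖ ^ 2 := by
  have h := inner_self_eq_norm_sq_to_K (𝕜 := ℂ) f
  rw [inner_Lp_eq_integral] at h
  simp_rw [Complex.conj_mul'] at h
  have h2 : ((‖f‖ ^ 2 : ℝ) : ℂ) = ((∫ t, ‖f t‖ ^ 2 : ℝ) : ℂ) := by
    rw [← integral_complex_ofReal]
    push_cast
    exact h.symm
  exact_mod_cast h2

/-- The points at distance at most `r` from the integers. -/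
def nearInt (r : ℝ) : Set ℝ := ⋃ k : ℤ, {u | |u + k| ≤ r}

theorem measurableSet_nearInt (r : ℝ) : MeasurableSet (nearInt r) :=
  MeasurableSet.iUnion fun _ => (isClosed_le (by fun_prop) (by fun_prop)).measurableSet

/-- For a radius below 1/2 the intervals around distinct integers are disjoint, so at most one term
is nonzero. -/
theorem sum_indicator_le_nearInt {r : ℝ} (hr : r < 1 / 2) (s : Finset ℤ) {g : ℝ → ℝ}
    (hg : ∀ u, 0 ≤ g u) (u : ℝ) :
    ∑ k ∈ s, {u : ℝ | |u + k| ≤ r}.indicator g u ≤ (nearInt r).indicator g u := by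
  by_cases h : ∃ k ∈ s, |u + (k : ℤ)| ≤ r
  · obtain ⟨k, hk, hku⟩ := h
    rw [Finset.sum_eq_single_of_mem k hk, Set.indicator_of_mem (show u ∈ {u : ℝ | |u + k| ≤ r} from hku),
      Set.indicator_of_mem (show u ∈ nearInt r from Set.mem_iUnion.2 ⟨k, hku⟩)]
    intro l _ hl
    refine Set.indicator_of_notMem (fun hlu => hl ?_) _
    have h1 : |(l : ℝ) - k| < 1 := by
      have : (l : ℝ) - k = (u + l) - (u + k) := by ring
      rw [this]
      have hlu' : |u + l| ≤ r := hlu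
      linarith [abs_sub (u + l) (u + k)]
    have h2 : |l - k| < 1 := by exact_mod_cast h1
    have := Int.abs_lt_one_iff.1 h2
    omega
  · push Not at h
    rw [Finset.sum_eq_zero]
    · exact Set.indicator_nonneg (fun _ _ => hg _) _
    · intro k hk
      exact Set.indicator_of_notMem (show u ∉ {u : ℝ | |u + k| ≤ r} from not_le.2 (h k hk)) _

/-- Cauchy–Schwarz, after cutting the atom down to [-R, R] and substituting u = 2^j t - k. -/
theorem norm_inner_atom_sq_le (φ f : Lp ℂ 2 (volume : Measure ℝ)) {R : ℝ}
    (hf : ∀ᵐ t, R < |t| → f t = 0) (j k : ℤ) :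
    ‖inner ℂ (atom φ j k) f‖ ^ 2 ≤
      (∫ u, {u : ℝ | |u + k| ≤ 2 ^ j * R}.indicator (fun u => ‖φ u‖ ^ 2) u) * ‖f‖ ^ 2 := by
  have hB : MeasurableSet {t : ℝ | |t| ≤ R} :=
    (isClosed_le (by fun_prop) (by fun_prop)).measurableSet
  have hmem := (Lp.memLp (atom φ j k)).indicator hB
  have h1 : inner ℂ (atom φ j k) f = inner ℂ hmem.toLp f := by
    rw [inner_Lp_eq_integral, inner_Lp_eq_integral]
    refine integral_congr_ae ?_
    filter_upwards [hf, hmem.coeFn_toLp] with t h1 h2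
    rw [h2]
    by_cases ht : |t| ≤ R
    · rw [Set.indicator_of_mem (show t ∈ {t : ℝ | |t| ≤ R} from ht)]
    · rw [h1 (not_le.1 ht), mul_zero, mul_zero]
  have h2 : ‖hmem.toLp‖ ^ 2 =
      ∫ u, {u : ℝ | |u + k| ≤ 2 ^ j * R}.indicator (fun u => ‖φ u‖ ^ 2) u := by
    rw [norm_sq_eq_integral]
    have h3 : (fun t => ‖(hmem.toLp _) t‖ ^ 2) =ᵐ[volume] fun t => (2 : ℝ) ^ j *
        {u : ℝ | |u + k| ≤ 2 ^ j * R}.indicator (fun u => ‖φ u‖ ^ 2) (2 ^ j * t - k) := by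
      filter_upwards [hmem.coeFn_toLp, coeFn_modDilLp (2 ^ j) k 0 (two_zpow_pos j) φ] with t e1 e2
      rw [e1]
      have e3 : 2 ^ j * t - k ∈ {u : ℝ | |u + k| ≤ 2 ^ j * R} ↔ t ∈ {t : ℝ | |t| ≤ R} := by
        rw [Set.mem_ofPred_eq, Set.mem_ofPred_eq, sub_add_cancel, abs_mul,
          abs_of_pos (two_zpow_pos j), mul_le_mul_iff_right₀ (two_zpow_pos j)]
      by_cases ht : t ∈ {t : ℝ | |t| ≤ R}
      · rw [Set.indicator_of_mem ht, Set.indicator_of_mem (e3.2 ht), atom, e2,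
          norm_modDil_sq (two_zpow_pos j)]
      · rw [Set.indicator_of_notMem ht, Set.indicator_of_notMem (fun h => ht (e3.1 h))]
        simp
    rw [integral_congr_ae h3, integral_const_mul, integral_comp_affine (two_zpow_pos j) k,
      smul_eq_mul, mul_inv_cancel_left₀ (two_zpow_pos j).ne']
  rw [h1, ← h2, ← mul_pow]
  exact pow_le_pow_left₀ (norm_nonneg _) (norm_inner_le_norm _ _) 2

/-- The sets shrink to the integers, a null set. -/
theorem tendsto_setIntegral_nearInt {g : ℝ → ℝ} (hg : Integrable g) (R : ℝ) :
    Tendsto (fun n : ℕ => ∫ u, (nearInt (2 ^ (-(n : ℤ)) * R)).indicator g u) atTop (𝓝 0) := by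
  have hr : Tendsto (fun n : ℕ => (2 : ℝ) ^ (-(n : ℤ)) * R) atTop (𝓝 0) := by
    have h := (tendsto_pow_atTop_nhds_zero_of_lt_one (r := (1 / 2 : ℝ)) (by norm_num)
      (by norm_num)).mul_const R
    rw [zero_mul] at h
    refine h.congr fun n => ?_
    rw [zpow_neg, zpow_natCast, one_div, inv_pow]
  have h0 : ∫ _ : ℝ, (0 : ℝ) = 0 := integral_zero _ _
  rw [← h0]
  refine tendsto_integral_of_dominated_convergence (fun u => ‖g u‖)
    (fun n => hg.1.indicator (measurableSet_nearInt _)) hg.norm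
    (fun n => .of_forall fun u => norm_indicator_le_norm_self _ _) ?_
  have hnull : ∀ᵐ u : ℝ, u ∉ Set.range ((↑) : ℤ → ℝ) :=
    (Set.countable_range _).ae_notMem volume
  filter_upwards [hnull] with u hu
  have hpos : 0 < |u - round u| :=
    abs_pos.2 fun h => hu ⟨round u, (sub_eq_zero.1 h).symm⟩
  refine tendsto_const_nhds.congr' ?_
  filter_upwards [hr.eventually (gt_mem_nhds hpos)] with n hn
  refine (Set.indicator_of_notMem (fun hmem => ?_) _).symm
  obtain ⟨k, hk⟩ := Set.mem_iUnion.1 hmem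
  have h1 := round_le u (-k)
  push_cast at h1
  rw [sub_neg_eq_add] at h1
  exact absurd (h1.trans hk) (not_le.2 hn)

/-- The intersection of the scaling spaces is trivial. -/
theorem eq_zero_of_mem_closure_span_atom {φ : Lp ℂ 2 (volume : Measure ℝ)}
    (hφ : ∀ j, Orthonormal ℂ (atom φ j)) (g : Lp ℂ 2 (volume : Measure ℝ))
    (hg : ∀ j, g ∈ (Submodule.span ℂ (Set.range (atom φ j))).topologicalClosure) : g = 0 := by
  have hφ2 : Integrable fun u => ‖φ u‖ ^ 2 :=
    (memLp_two_iff_integrable_sq_norm (Lp.memLp φ).1).1 (Lp.memLp φ)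
  have hg2 : Integrable fun u => ‖g u‖ ^ 2 :=
    (memLp_two_iff_integrable_sq_norm (Lp.memLp g).1).1 (Lp.memLp g)
  have key : ∀ R : ℕ, ∀ᵐ t, t ∈ {t : ℝ | |t| ≤ R} → g t = 0 := by
    intro R
    have hB : MeasurableSet {t : ℝ | |t| ≤ (R : ℝ)} :=
      (isClosed_le (by fun_prop) (by fun_prop)).measurableSet
    have hmem := (Lp.memLp g).indicator hB
    set f : Lp ℂ 2 (volume : Measure ℝ) := hmem.toLp with hf
    have hfR : ∀ᵐ t, (R : ℝ) < |t| → f t = 0 := by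
      filter_upwards [hmem.coeFn_toLp] with t ht hRt
      rw [hf, ht]
      exact Set.indicator_of_notMem (show t ∉ {t : ℝ | |t| ≤ (R : ℝ)} from not_le.2 hRt) _
    have hlim := ((tendsto_setIntegral_nearInt hφ2 R).mul_const (‖f‖ ^ 2)).sqrt.const_mul ‖g‖
    -- At scale -n the coefficients of f = g·1_{|t| ≤ R} have square sum at most ‖f‖² times the mass
    -- of |φ|² near the integers, which tends to 0. Hence ⟨g, f⟩ = 0, and this is the integral of
    -- |g|² over |t| ≤ R.
    rw [zero_mul, Real.sqrt_zero, mul_zero] at hlim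
    have hsmall : ∀ᶠ n : ℕ in atTop, (2 : ℝ) ^ (-(n : ℤ)) * R < 1 / 2 := by
      filter_upwards [(tendsto_pow_atTop_atTop_of_one_lt (one_lt_two (α := ℝ))).eventually_gt_atTop
        (2 * (R : ℝ))] with n hn
      rw [zpow_neg, zpow_natCast, inv_mul_lt_iff₀ (by positivity)]
      linarith
    have hzero : ‖inner ℂ g f‖ ≤ 0 := by
      refine ge_of_tendsto hlim ?_
      filter_upwards [hsmall] with n hn
      refine norm_inner_le_of_mem_closure_span (hφ (-(n : ℤ))) f (fun s => ?_) (hg _)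
      have hint : ∀ k ∈ s, Integrable
          ({u : ℝ | |u + (k : ℤ)| ≤ 2 ^ (-(n : ℤ)) * (R : ℝ)}.indicator (fun u => ‖φ u‖ ^ 2)) :=
        fun k _ => hφ2.indicator (isClosed_le (by fun_prop) (by fun_prop)).measurableSet
      refine (Finset.sum_le_sum fun k _ => norm_inner_atom_sq_le φ f hfR (-(n : ℤ)) k).trans ?_
      rw [← Finset.sum_mul, ← integral_finsetSum s hint]
      refine mul_le_mul_of_nonneg_right ?_ (sq_nonneg _)
      refine integral_mono (integrable_finsetSum s hint)
        (hφ2.indicator (measurableSet_nearInt _)) fun u => ?_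
      exact sum_indicator_le_nearInt hn s (fun _ => sq_nonneg _) u
    have hz : inner ℂ g f = 0 := norm_le_zero_iff.1 hzero
    rw [inner_Lp_eq_integral] at hz
    have h1 : (fun t => (starRingEnd ℂ) (g t) * f t) =ᵐ[volume]
        fun t => (({t : ℝ | |t| ≤ (R : ℝ)}.indicator (fun t => ‖g t‖ ^ 2) t : ℝ) : ℂ) := by
      filter_upwards [hmem.coeFn_toLp] with t ht
      rw [hf, ht]
      by_cases htR : t ∈ {t : ℝ | |t| ≤ (R : ℝ)}
      · rw [Set.indicator_of_mem htR, Set.indicator_of_mem htR, Complex.conj_mul',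
          Complex.ofReal_pow]
      · rw [Set.indicator_of_notMem htR, Set.indicator_of_notMem htR, mul_zero, Complex.ofReal_zero]
    rw [integral_congr_ae h1, integral_complex_ofReal, Complex.ofReal_eq_zero,
      integral_eq_zero_iff_of_nonneg
        (fun t => Set.indicator_nonneg (fun _ _ => sq_nonneg _) t) (hg2.indicator hB)] at hz
    filter_upwards [hz] with t ht htR
    rw [Set.indicator_of_mem (show t ∈ {t : ℝ | |t| ≤ (R : ℝ)} from htR)] at ht
    exact norm_eq_zero.1 (pow_eq_zero_iff two_ne_zero |>.1 ht)
  apply Lp.ext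
  refine .trans ?_ (Lp.coeFn_zero ℂ 2 (volume : Measure ℝ)).symm
  filter_upwards [ae_all_iff.2 key] with t ht
  obtain ⟨n, hn⟩ := exists_nat_ge |t|
  exact ht n hn

/-- The dilates and translates of the wavelet of a Cohen filter form a Hilbert basis. -/
theorem IsCohenFilter.exists_hilbertBasis {p : ℝ[X]} (hp : IsCohenFilter p)
    {φ ψ : Lp ℂ 2 (volume : Measure ℝ)} (hφ : fourierFun φ =ᵐ[volume] scalingHat p)
    (hψ : fourierFun ψ =ᵐ[volume] waveletHat p) :
    ∃ b : HilbertBasis (ℤ × ℤ) ℂ (Lp ℂ 2 (volume : Measure ℝ)),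
      ∀ i, b i = atom ψ i.1 i.2 :=
  exists_hilbertBasis_of_multiresolution (atom φ) (atom ψ) (hp.orthonormal_wavelet hψ)
    (hp.inner_scaling_wavelet hφ hψ)
    (atom_mem_span_succ hφ hφ (lowPass_mem_trigPoly p) hp.scalingHat_two_mul)
    (atom_mem_span_succ hφ hψ (highResponse_mem_trigPoly p) (waveletHat_two_mul p))
    (hp.scaling_mem_sup hφ hψ) (eq_zero_of_mem_closure_span_atom (hp.orthonormal_scaling hφ))
    (hp.eq_zero_of_inner_scaling hφ)

/-! ### The polynomial D_L has no zero on the unit circle. -/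

theorem thiranCoeff_mul_eq_choose (L ℓ : ℕ) (h : ℓ ≤ L) :
    thiranCoeff L ℓ * (2 * L + 1) = (2 * L + 1).choose (2 * ℓ + 1) := by
  induction ℓ with
  | zero => simp [thiranCoeff]
  | succ ℓ ih =>
    have ih := ih (by omega)
    -- Both sides have the ratio (L-ℓ)(2L-2ℓ-1) / ((ℓ+1)(2ℓ+3)) between consecutive terms; `c2` and
    -- `c3` give it for the right side in two unit steps.
    have c1 : (L.choose (ℓ + 1) : ℝ) * (ℓ + 1) = L.choose ℓ * (L - ℓ) := by
      have := Nat.choose_succ_right_eq L ℓ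
      rw [← Nat.cast_sub (by omega : ℓ ≤ L)]
      exact_mod_cast this
    have c2 : ((2 * L + 1).choose (2 * ℓ + 2) : ℝ) * (2 * ℓ + 2) =
        (2 * L + 1).choose (2 * ℓ + 1) * (2 * L - 2 * ℓ) := by
      have := Nat.choose_succ_right_eq (2 * L + 1) (2 * ℓ + 1)
      have e : 2 * L + 1 - (2 * ℓ + 1) = 2 * (L - ℓ) := by omega
      rw [e] at this
      rw [← mul_sub, ← Nat.cast_sub (by omega : ℓ ≤ L)]
      exact_mod_cast this
    have c3 : ((2 * L + 1).choose (2 * ℓ + 3) : ℝ) * (2 * ℓ + 3) =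
        (2 * L + 1).choose (2 * ℓ + 2) * (2 * L - 2 * ℓ - 1) := by
      have := Nat.choose_succ_right_eq (2 * L + 1) (2 * ℓ + 2)
      have e : ((2 * L + 1 - (2 * ℓ + 2) : ℕ) : ℝ) = 2 * L - 2 * ℓ - 1 := by
        rw [Nat.cast_sub (by omega)]
        push_cast
        ring
      rw [← e]
      exact_mod_cast this
    have d1 : thiranCoeff L (ℓ + 1) * ((ℓ + 1) * (2 * ℓ + 3)) =
        thiranCoeff L ℓ * ((L - ℓ) * (2 * L - 2 * ℓ - 1)) := by
      have h0 : (3 / 2 + ℓ : ℝ) ≠ 0 := by positivity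
      have h1 : (1 / 2 - (L : ℝ) + ℓ) / (3 / 2 + ℓ) * (2 * ℓ + 3) = 1 - 2 * L + 2 * ℓ := by
        field_simp
        ring
      simp only [thiranCoeff, Finset.prod_range_succ]
      generalize (∏ k ∈ Finset.range ℓ, ((1 / 2 - (L : ℝ) + k) / (3 / 2 + k))) = P
      rw [pow_succ]
      linear_combination ((-1) ^ ℓ * (-1) * P) * ((L.choose (ℓ + 1) : ℝ) * (ℓ + 1) * h1 +
        (1 - 2 * L + 2 * ℓ) * c1)
    have e3 : 2 * (ℓ + 1) + 1 = 2 * ℓ + 3 := by ring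
    rw [e3]
    have hne : ((ℓ : ℝ) + 1) * (2 * ℓ + 3) ≠ 0 := by positivity
    refine mul_right_cancel₀ hne ?_
    linear_combination (2 * (L : ℝ) + 1) * d1 + ((L : ℝ) - ℓ) * (2 * L - 2 * ℓ - 1) * ih -
      (ℓ + 1) * c3 - (1 / 2) * (2 * L - 2 * ℓ - 1) * c2

theorem sum_range_two_mul {R : Type*} [AddCommMonoid R] (f : ℕ → R) (n : ℕ) :
    ∑ i ∈ Finset.range (2 * n), f i = ∑ i ∈ Finset.range n, (f (2 * i) + f (2 * i + 1)) := by
  induction n with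
  | zero => simp
  | succ n ih =>
    rw [mul_add, mul_one, Finset.sum_range_succ, Finset.sum_range_succ, ih,
      Finset.sum_range_succ, add_assoc]

theorem thiranD_eq_sum_range (L : ℕ) (z : ℂ) :
    thiranD L z = ∑ ℓ ∈ Finset.range (L + 1), (thiranCoeff L ℓ : ℂ) * z⁻¹ ^ ℓ := by
  rw [thiranD, Finset.sum_range_eq_add_Ico _ (by omega)]
  congr 1
  simp [thiranCoeff]

/-- `D_L(w^{-2}) = ((1 + w)^{2L+1} - (1 - w)^{2L+1}) / (2 (2L+1) w)`. -/
theorem two_mul_mul_thiranD (L : ℕ) (w z : ℂ) (hw : w ^ 2 = z⁻¹) :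
    2 * ((2 * L + 1) * w) * thiranD L z = (1 + w) ^ (2 * L + 1) - (1 - w) ^ (2 * L + 1) := by
  have h1 : ∀ x : ℂ, (1 + x) ^ (2 * L + 1) = ∑ ℓ ∈ Finset.range (L + 1),
      (x ^ (2 * ℓ) * (2 * L + 1).choose (2 * ℓ) +
        x ^ (2 * ℓ + 1) * (2 * L + 1).choose (2 * ℓ + 1)) := by
    intro x
    rw [add_comm, add_pow, ← sum_range_two_mul
      (fun i => x ^ i * ((2 * L + 1).choose i : ℂ)) (L + 1)]
    simp only [one_pow, mul_one]
    rfl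
  rw [h1, sub_eq_add_neg 1 w, h1, ← Finset.sum_sub_distrib, thiranD_eq_sum_range, Finset.mul_sum]
  refine Finset.sum_congr rfl fun ℓ hℓ => ?_
  have h2 := congrArg (fun r : ℝ => (r : ℂ))
    (thiranCoeff_mul_eq_choose L ℓ (by simpa [Nat.lt_succ_iff] using hℓ))
  push_cast at h2
  rw [← hw, ← h2, (even_two_mul ℓ).neg_pow, (odd_two_mul_add_one ℓ).neg_pow, ← pow_mul]
  ring

/-- With w² = 1/z, a zero forces (1+w)^{2L+1} = (1-w)^{2L+1}, so |1+w| = |1-w| and w is imaginary of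
modulus 1, that is w² = -1. Then 1 + w = w(1 - w) gives w^{2L+1} = 1, whose square reads -1 = 1. -/
theorem thiranD_ne_zero (L : ℕ) {z : ℂ} (hz : ‖z‖ = 1) : thiranD L z ≠ 0 := by
  intro h0
  obtain ⟨w, hw⟩ := IsSquare.exists_sq z⁻¹ (IsAlgClosed.exists_eq_mul_self z⁻¹)
  have h1 := two_mul_mul_thiranD L w z hw.symm
  rw [h0, mul_zero, eq_comm, sub_eq_zero] at h1
  have h2 : ‖1 + w‖ = ‖1 - w‖ := by
    have := congrArg norm h1
    rw [norm_pow, norm_pow] at this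
    exact (pow_left_inj₀ (norm_nonneg _) (norm_nonneg _) (by omega)).1 this
  have hre : w.re = 0 := by
    have := congrArg (fun r => r ^ 2) h2
    simp only [Complex.sq_norm, Complex.normSq_apply, Complex.add_re, Complex.add_im,
      Complex.sub_re, Complex.sub_im, Complex.one_re, Complex.one_im] at this
    linarith
  have hnorm : ‖w‖ ^ 2 = 1 := by
    rw [← norm_pow, ← hw, norm_inv, hz, inv_one]
  have him : w.im ^ 2 = 1 := by
    rw [Complex.sq_norm, Complex.normSq_apply, hre] at hnorm
    linarith
  have hsq : w ^ 2 = -1 := by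
    apply Complex.ext
    · simp only [sq, Complex.mul_re, hre, Complex.neg_re, Complex.one_re]
      linarith
    · simp [sq, hre]
  have h3 : 1 + w = w * (1 - w) := by linear_combination hsq
  have h4 : (1 - w) ≠ 0 := by
    intro h
    have : w = 1 := (sub_eq_zero.1 h).symm
    rw [this] at hre
    simp at hre
  rw [h3, mul_pow] at h1
  have h5 : w ^ (2 * L + 1) = 1 :=
    mul_right_cancel₀ (pow_ne_zero (2 * L + 1) h4) (by rw [h1, one_mul])
  have h6 : (w ^ 2) ^ (2 * L + 1) = 1 := by
    rw [← pow_mul, mul_comm, pow_mul, h5, one_pow]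
  rw [hsq, (odd_two_mul_add_one L).neg_one_pow] at h6
  norm_num at h6

/-! ### From transfer functions to Cohen filters and real wavelets. -/

theorem lowPass_eq_causalTransfer (p : ℝ[X]) (ξ : ℝ) : lowPass p ξ = causalTransfer p (cis ξ) := by
  rw [lowPass, causalTransfer, cis_neg]

theorem cis_add_half (ξ : ℝ) : cis (ξ + 1 / 2) = -cis ξ := by
  rw [cis_add, cis_half, mul_neg_one]

theorem cis_ne_neg_one {ξ : ℝ} (hξ : |ξ| ≤ 1 / 4) : cis ξ ≠ -1 := by
  intro h
  have h1 : 0 ≤ Real.cos (2 * Real.pi * ξ) := by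
    have := abs_le.1 hξ
    refine Real.cos_nonneg_of_mem_Icc ⟨?_, ?_⟩ <;> nlinarith [Real.pi_pos]
  have h2 := congrArg Complex.re h
  rw [cis, Complex.exp_ofReal_mul_I_re, Complex.neg_re, Complex.one_re] at h2
  linarith

/-- A filter with the perfect reconstruction property which vanishes on the unit circle at most at
`-1` satisfies the Cohen conditions. -/
theorem isCohenFilter_of_transfer {A : ℂ → ℂ} {p : ℝ[X]}
    (hA : ∀ z : ℂ, z ≠ 0 → ((Real.sqrt 2)⁻¹ : ℂ) * A z = causalTransfer p z)
    (hone : A 1 = (Real.sqrt 2 : ℂ))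
    (hpr : ∀ z : ℂ, z ≠ 0 → A z * A z⁻¹ + A (-z) * A (-z)⁻¹ = 2)
    (hne : ∀ z : ℂ, ‖z‖ = 1 → z ≠ -1 → A z ≠ 0) : IsCohenFilter p := by
  have hs : (Real.sqrt 2 : ℂ) ≠ 0 := by simp
  have hs2 : ((Real.sqrt 2)⁻¹ : ℂ) * (Real.sqrt 2 : ℂ)⁻¹ = 1 / 2 := by
    rw [← mul_inv, ← Complex.ofReal_mul, Real.mul_self_sqrt zero_le_two]
    norm_num
  have hlow : ∀ ξ, lowPass p ξ = ((Real.sqrt 2)⁻¹ : ℂ) * A (cis ξ) := fun ξ => by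
    rw [lowPass_eq_causalTransfer, hA _ (cis_ne_zero ξ)]
  -- Real coefficients make conj m(ξ) = m(-ξ), which turns |m|² into A(z)A(1/z)/2 on the circle.
  have hnormsq : ∀ ξ, ((‖lowPass p ξ‖ ^ 2 : ℝ) : ℂ) = 1 / 2 * (A (cis ξ) * A (cis ξ)⁻¹) := by
    intro ξ
    rw [Complex.ofReal_pow, ← Complex.mul_conj', ← lowPass_neg, hlow, hlow, cis_neg, ← hs2]
    ring
  refine ⟨?_, fun ξ => ?_, fun ξ hξ => ?_⟩
  · rw [hlow, cis_zero, hone, inv_mul_cancel₀ hs]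
  · have h1 := hpr (cis ξ) (cis_ne_zero ξ)
    have h2 : ((‖lowPass p ξ‖ ^ 2 + ‖lowPass p (ξ + 1 / 2)‖ ^ 2 : ℝ) : ℂ) = 1 := by
      rw [Complex.ofReal_add, hnormsq, hnormsq, cis_add_half]
      linear_combination (1 / 2) * h1
    exact_mod_cast h2
  · rw [hlow]
    exact mul_ne_zero (inv_ne_zero hs) (hne _ (norm_cis ξ) (cis_ne_neg_one hξ))

theorem exp_two_pi_eq_cis (x : ℝ) (y : ℝ) (h : y = 2 * Real.pi * x) :
    Complex.exp (Complex.I * (y : ℝ)) = cis x := by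
  rw [cis, h, mul_comm]

theorem scalingFactor_eq {A : ℂ → ℂ} {p : ℝ[X]}
    (hA : ∀ z : ℂ, z ≠ 0 → ((Real.sqrt 2)⁻¹ : ℂ) * A z = causalTransfer p z) (ξ : ℝ) (j : ℕ) :
    scalingFactor A (2 * Real.pi * ξ) j = lowPass p (ξ / 2 ^ j) := by
  rw [scalingFactor, exp_two_pi_eq_cis (ξ / 2 ^ j), hA _ (cis_ne_zero _),
    lowPass_eq_causalTransfer]
  field_simp

theorem fatherHat_eq {A : ℂ → ℂ} {p : ℝ[X]}
    (hA : ∀ z : ℂ, z ≠ 0 → ((Real.sqrt 2)⁻¹ : ℂ) * A z = causalTransfer p z) (ξ : ℝ) :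
    fatherHat A (2 * Real.pi * ξ) = scalingHat p ξ := by
  simp only [fatherHat, scalingHat, scalingFactor_eq hA]

theorem motherHat_eq {A : ℂ → ℂ} {p : ℝ[X]}
    (hA : ∀ z : ℂ, z ≠ 0 → ((Real.sqrt 2)⁻¹ : ℂ) * A z = causalTransfer p z) (ξ : ℝ) :
    motherHat A (2 * Real.pi * ξ) = waveletHat p ξ := by
  have h1 : 2 * Real.pi * ξ / 2 = 2 * Real.pi * (ξ / 2) := by ring
  have h2 : (starRingEnd ℂ) (lowPass p (ξ / 2 + 1 / 2)) =
      ((Real.sqrt 2)⁻¹ : ℂ) * A (-(cis (ξ / 2))⁻¹) := by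
    rw [hA _ (neg_ne_zero.2 (inv_ne_zero (cis_ne_zero _))), ← lowPass_neg,
      lowPass_eq_causalTransfer, cis_neg, cis_add_half, inv_neg]
  rw [motherHat, h1, fatherHat_eq hA, exp_two_pi_eq_cis (ξ / 2) _ rfl, highPass, waveletHat,
    highResponse, h2, cis_neg]
  ring

theorem waveletHat_neg {p : ℝ[X]} (hp : IsCohenFilter p) (ξ : ℝ) :
    waveletHat p (-ξ) = (starRingEnd ℂ) (waveletHat p ξ) := by
  have h1 : lowPass p (-(ξ / 2) + 1 / 2) = (starRingEnd ℂ) (lowPass p (ξ / 2 + 1 / 2)) := by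
    rw [← lowPass_neg, ← lowPass_add_one p (-(ξ / 2 + 1 / 2))]
    congr 1
    ring
  rw [waveletHat, waveletHat, neg_div, hp.scalingHat_neg, highResponse, highResponse, h1]
  simp only [map_mul, conj_cis, Complex.conj_conj]

/-- A square integrable Hermitian function is the Fourier transform of a real-valued function. -/
theorem exists_hasL2FourierTransform {g : ℝ → ℂ} {G : ℝ → ℂ} (hG : MemLp G 2 volume)
    (hneg : ∀ ξ, G (-ξ) = (starRingEnd ℂ) (G ξ)) (hg : ∀ ξ, g (2 * Real.pi * ξ) = G ξ) :
    ∃ f : ℝ → ℝ, HasL2FourierTransform f g := by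
  obtain ⟨f, hf⟩ : ∃ f : Lp ℂ 2 (volume : Measure ℝ), 𝓕 f = hG.toLp :=
    (Lp.fourierTransformₗᵢ ℝ ℂ).surjective _
  have him := ae_im_eq_zero_of_fourier_hermitian f (by
    rw [hf]
    filter_upwards [hG.coeFn_toLp,
      (Measure.measurePreserving_neg (volume : Measure ℝ)).quasiMeasurePreserving.ae
        hG.coeFn_toLp] with x h1 h2
    rw [h1, h2, hneg])
  have hre : (fun t => ((f t).re : ℂ)) =ᵐ[volume] f := by
    filter_upwards [him] with t ht
    exact Complex.ext (by simp) (by simp [ht])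
  have hmem : MemLp (fun t => ((f t).re : ℂ)) 2 volume := (memLp_congr_ae hre).2 (Lp.memLp f)
  refine ⟨fun t => (f t).re, hmem, ?_⟩
  have heq : hmem.toLp = f := Lp.ext (hmem.coeFn_toLp.trans hre)
  rw [heq, hf]
  refine hG.coeFn_toLp.trans (.of_forall fun ξ => ?_)
  exact (hg ξ).symm

theorem sqrt_two_zpow (j : ℤ) : √((2 : ℝ) ^ j) = (2 : ℝ) ^ ((j : ℝ) / 2) := by
  rw [Real.sqrt_eq_rpow, ← Real.rpow_intCast, ← Real.rpow_mul zero_le_two]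
  congr 1
  ring

/-- The father and mother wavelets of a Cohen filter exist, and the mother wavelet generates an
orthonormal basis. -/
theorem exists_isWaveletPair_and_basis {A : ℂ → ℂ} {p : ℝ[X]} (hp : IsCohenFilter p)
    (hA : ∀ z : ℂ, z ≠ 0 → ((Real.sqrt 2)⁻¹ : ℂ) * A z = causalTransfer p z) :
    (∃ φ ψ : ℝ → ℝ, IsWaveletPair A φ ψ) ∧
      ∀ φ ψ : ℝ → ℝ, IsWaveletPair A φ ψ → IsOrthonormalBasisL2 (dilate ψ) := by
  constructor
  · obtain ⟨φ, hφ⟩ := exists_hasL2FourierTransform hp.memLp_scalingHat hp.scalingHat_neg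
      (fatherHat_eq hA)
    obtain ⟨ψ, hψ⟩ := exists_hasL2FourierTransform hp.memLp_waveletHat (waveletHat_neg hp)
      (motherHat_eq hA)
    refine ⟨φ, ψ, fun ω => ?_, hφ, hψ⟩
    have h : ω = 2 * Real.pi * (ω / (2 * Real.pi)) :=
      (mul_div_cancel₀ _ Real.two_pi_pos.ne').symm
    rw [h]
    simp only [scalingFactor_eq hA]
    exact hp.multipliable _
  · rintro φ ψ ⟨-, ⟨hφ, hφ'⟩, ⟨hψ, hψ'⟩⟩
    simp only [fatherHat_eq hA] at hφ'
    simp only [motherHat_eq hA] at hψ'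
    obtain ⟨b, hb⟩ := hp.exists_hilbertBasis hφ' hψ'
    refine ⟨b, fun i => ?_⟩
    rw [hb]
    refine (coeFn_modDilLp _ _ _ (two_zpow_pos i.1) _).trans
      ((modDil_congr_ae (two_zpow_pos i.1) _ _ hψ.coeFn_toLp).trans (.of_forall fun t => ?_))
    simp only [modDil, dilate, zero_mul, cis_zero, mul_one, sqrt_two_zpow, Complex.ofReal_mul]

/-! ### The two filters of the Hilbert pair. -/

/-- `1 + ∑_{ℓ=1}^L d(ℓ) X^ℓ`. -/
def thiranPoly (L : ℕ) : ℝ[X] := 1 + ∑ ℓ ∈ Finset.Icc 1 L, C (thiranCoeff L ℓ) * X ^ ℓ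

theorem causalTransfer_thiranPoly (L : ℕ) (z : ℂ) :
    causalTransfer (thiranPoly L) z = thiranD L z := by
  simp [causalTransfer, thiranPoly, thiranD]

/-- `X^L + ∑_{ℓ=1}^L d(ℓ) X^{L-ℓ}`. -/
def thiranReversed (L : ℕ) : ℝ[X] :=
  X ^ L + ∑ ℓ ∈ Finset.Icc 1 L, C (thiranCoeff L ℓ) * X ^ (L - ℓ)

/-- The delay z^{-L} makes D_L(1/z) a polynomial in 1/z, so that `G₀` too comes from a causal FIR
filter. -/
theorem causalTransfer_thiranReversed (L : ℕ) {z : ℂ} (hz : z ≠ 0) :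
    causalTransfer (thiranReversed L) z = thiranD L z⁻¹ * z⁻¹ ^ L := by
  rw [thiranD, add_mul, one_mul, Finset.sum_mul]
  simp only [causalTransfer, thiranReversed, map_add, map_pow, aeval_X, map_sum, map_mul, aeval_C,
    Complex.coe_algebraMap]
  congr 1
  refine Finset.sum_congr rfl fun ℓ hℓ => ?_
  rw [← Nat.sub_add_cancel (Finset.mem_Icc.1 hℓ).2, pow_add, Nat.add_sub_cancel, inv_inv,
    Nat.sub_add_cancel (Finset.mem_Icc.1 hℓ).2, inv_pow z ℓ]
  field_simp

/-- The transfer functions of the filters `c q (1 + X)^M d`. -/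
theorem causalTransfer_mul_pow_mul (c : ℝ) (q d : ℝ[X]) (M : ℕ) (z : ℂ) :
    causalTransfer (C c * (q * (1 + X) ^ M * d)) z =
      c * (causalTransfer q z * (1 + 1 / z) ^ M * causalTransfer d z) := by
  simp [causalTransfer]

end CommonFactorWavelet

end

open CommonFactorWavelet in
theorem mainTheorem5 (L M : ℕ) (hL : 0 < L) (hM : 0 < M)
    (Q : Polynomial ℝ) (hQ : CommonFactorWavelet.IsSpectralFactor L M Q)
    (F H₀ G₀ : ℂ → ℂ)
    (hF : ∀ z : ℂ, z ≠ 0 →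
      F z = CommonFactorWavelet.causalTransfer Q z * (1 + 1 / z) ^ M)
    (hHG : CommonFactorWavelet.IsApproxHilbertPair L F H₀ G₀) :
    ((∃ φ ψ : ℝ → ℝ, CommonFactorWavelet.IsWaveletPair H₀ φ ψ) ∧
      ∀ φ ψ : ℝ → ℝ, CommonFactorWavelet.IsWaveletPair H₀ φ ψ →
        CommonFactorWavelet.IsOrthonormalBasisL2 (CommonFactorWavelet.dilate ψ)) ∧
    ((∃ φ ψ : ℝ → ℝ, CommonFactorWavelet.IsWaveletPair G₀ φ ψ) ∧
      ∀ φ ψ : ℝ → ℝ, CommonFactorWavelet.IsWaveletPair G₀ φ ψ →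
        CommonFactorWavelet.IsOrthonormalBasisL2 (CommonFactorWavelet.dilate ψ)) := by
  obtain ⟨r, q, -, hPR, hR, hQne⟩ := hQ
  have hFF : ∀ z : ℂ, z ≠ 0 → F z * F z⁻¹ =
      causalTransfer Q z * causalTransfer Q z⁻¹ * (2 + z + z⁻¹) ^ M := by
    intro z hz
    have h : 2 + z + z⁻¹ = (1 + 1 / z) * (1 + 1 / z⁻¹) := by
      field_simp
      ring
    rw [hF z hz, hF _ (inv_ne_zero hz), h, mul_pow]
    ring
  have hFne : ∀ z : ℂ, ‖z‖ = 1 → z ≠ -1 → F z ≠ 0 := by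
    intro z hz hz1
    have hz0 : z ≠ 0 := norm_ne_zero_iff.1 (by rw [hz]; exact one_ne_zero)
    rw [hF z hz0]
    refine mul_ne_zero ?_ (pow_ne_zero _ fun h => hz1 ?_)
    · have := hQne z⁻¹ (by rw [norm_inv, hz, inv_one])
      rwa [inv_inv] at this
    · field_simp at h
      linear_combination h
  -- The left side is R(z)S(z) + R(-z)S(-z), whichever of the two filters A is.
  have hprod : ∀ A : ℂ → ℂ, (∀ z : ℂ, z ≠ 0 → A z * A z⁻¹ =
      F z * F z⁻¹ * (thiranD L z * thiranD L z⁻¹)) →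
      ∀ z : ℂ, z ≠ 0 → A z * A z⁻¹ + A (-z) * A (-z)⁻¹ = 2 := by
    intro A hA z hz
    have hz' := neg_ne_zero.2 hz
    have h := hPR z hz
    rw [symbolS, symbolS] at h
    rw [hA z hz, hA _ hz', hFF z hz, hFF _ hz', ← hR z hz, ← hR _ hz']
    linear_combination h
  constructor
  · refine exists_isWaveletPair_and_basis
      (p := C (Real.sqrt 2)⁻¹ * (Q * (1 + X) ^ M * thiranPoly L))
      (isCohenFilter_of_transfer ?hA hHG.H_one (hprod _ fun z hz => ?_)
        fun z hz hz1 => ?_) ?hA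
    case hA =>
      intro z hz
      rw [causalTransfer_mul_pow_mul, causalTransfer_thiranPoly, hHG.eq_H z hz, hF z hz,
        Complex.ofReal_inv]
    · rw [hHG.eq_H z hz, hHG.eq_H _ (inv_ne_zero hz)]
      ring
    · rw [hHG.eq_H z (norm_ne_zero_iff.1 (by rw [hz]; exact one_ne_zero))]
      exact mul_ne_zero (hFne z hz hz1) (thiranD_ne_zero L hz)
  · refine exists_isWaveletPair_and_basis
      (p := C (Real.sqrt 2)⁻¹ * (Q * (1 + X) ^ M * thiranReversed L))
      (isCohenFilter_of_transfer ?hA' hHG.G_one (hprod _ fun z hz => ?_)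
        fun z hz hz1 => ?_) ?hA'
    case hA' =>
      intro z hz
      rw [causalTransfer_mul_pow_mul, causalTransfer_thiranReversed L hz, hHG.eq_G z hz, hF z hz,
        Complex.ofReal_inv]
      ring
    · rw [hHG.eq_G z hz, hHG.eq_G _ (inv_ne_zero hz), inv_inv]
      have : z⁻¹ ^ L * z ^ L = 1 := by rw [← mul_pow, inv_mul_cancel₀ hz, one_pow]
      linear_combination F z * F z⁻¹ * (thiranD L z * thiranD L z⁻¹) * this
    · have hz0 : z ≠ 0 := norm_ne_zero_iff.1 (by rw [hz]; exact one_ne_zero)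
      rw [hHG.eq_G z hz0]
      exact mul_ne_zero (mul_ne_zero (hFne z hz hz1)
        (thiranD_ne_zero L (by rw [norm_inv, hz, inv_one]))) (pow_ne_zero _ (inv_ne_zero hz0))
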